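/- **Theorem 3.5.** Let $f(z)=\sum_{k=0}^{\infty}a_kz^k$ be a formal power series with real coefficients. For $n=0,1,2,\dots$ let $$A(f,n)(z)=\sum_{k=0}^{n}\frac{n!}{(n-k)!}\,a_k z^{n-k}$$ be its $n$-th Appell polynomial. Put $S_0=[0,\infty)\subset\mathbb C$. For an entire function $F\not\equiv 0$ and $X\subset\mathbb C$ let $N(F;X)\in\{0,1,2,\dots,\infty\}$ be the number of zeros of $F$ in $X$ counted with multiplicity, put $N(0;X)=0$, and let $N_n=N(A(f,n);\mathbb C\setminus S_0)$. Let $\mathcal{LP}(S_0)$ be the class of real entire functions (entire functions that are real on $\mathbb R$) of the form $$g(z)=c\,z^m e^{-\alpha z}\prod_j\Bigl(1-\frac{z}{a_j}\Bigr),$$ where $c\in\mathbb R$, $m$ is a nonnegative integer, $\alpha\ge 0$, and $(a_j)$ is a finite (possibly empty) or infinite sequence of positive numbers with $\sum_j a_j^{-1}<\infty$. Let $\mathcal{LP}(S_0)^*$ be the class of real entire functions of the form $Pg$ with $P$ a real polynomial and $g\in\mathcal{LP}(S_0)$. The series $f$ is said to represent an entire function $F$ if it converges to $F(z)$ for every $z\in\mathbb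 C$. Then: 1. $0=N_0\le N_1\le N_2\le\cdots$. 2. If $f$ represents an entire function $F\in\mathcal{LP}(S_0)^*$ and $N=N(F;\mathbb C\setminus S_0)$, then $N_n\le N$ for all $n$, and $N_n=N$ for all sufficiently large $n$. 3. If the sequence $\langle N_n\rangle$ is bounded, then $f$ represents an entire function in $\mathcal{LP}(S_0)^*$. -/

import Mathlib

namespace PolyaAppell

noncomputable section

/-- `S₀ = [0, ∞)`, as a subset of the complex plane. -/
def S₀ : Set ℂ := {z : ℂ | 0 ≤ z.re ∧ z.im = 0}

open Classical in
/-- `N(F; X)`: the number of zeros of `F` lying in `X`, counted with multiplicity, as an element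
of `ℕ ∪ {∞}`; it is `0` by convention when `F` vanishes identically. The multiplicity of a point
is the order of vanishing, which is `0` at a point that is not a zero. -/
def zeroCount (F : ℂ → ℂ) (X : Set ℂ) : ℕ∞ :=
  if F = 0 then 0 else ∑' z : X, analyticOrderAt F (z : ℂ)

/-- The value of a real polynomial at a complex number. -/
def evalC (P : Polynomial ℝ) (z : ℂ) : ℂ := Polynomial.aeval z P

/-- The `n`-th Appell polynomial `A(f, n) = ∑_{k=0}^{n} n!/(n-k)! a_k z^{n-k}` of the formal power
series `f = ∑ a_k z^k`. -/
def appell (f : PowerSeries ℝ) (n : ℕ) : Polynomial ℝ :=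
  ∑ k ∈ Finset.range (n + 1),
    Polynomial.monomial (n - k)
      ((n.factorial : ℝ) / ((n - k).factorial : ℝ) * PowerSeries.coeff k f)

/-- `N_n = N(A(f, n); ℂ ∖ S₀)`. -/
def appellCount (f : PowerSeries ℝ) (n : ℕ) : ℕ∞ :=
  zeroCount (evalC (appell f n)) S₀ᶜ

/-- The formal power series `f` represents the entire function `F`: it converges to `F` at every
point of the complex plane. -/
def Represents (f : PowerSeries ℝ) (F : ℂ → ℂ) : Prop :=
  ∀ z : ℂ, HasSum (fun k : ℕ => ((PowerSeries.coeff k f : ℝ) : ℂ) * z ^ k) (F z)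

/-- A real entire function: entire, and real on the real axis. -/
def IsRealEntire (F : ℂ → ℂ) : Prop :=
  Differentiable ℂ F ∧ ∀ x : ℝ, (F x).im = 0

/-- The class `LP(S₀)` of the real entire functions
`c z^m e^{-α z} ∏_j (1 - z / a_j)` with `c` real, `m` a nonnegative integer, `α ≥ 0`, and `(a_j)` a
finite (possibly empty) or infinite sequence of positive reals with `∑_j 1 / a_j < ∞`. -/
def LP : Set (ℂ → ℂ) :=
  {g | IsRealEntire g ∧
    ∃ (c : ℝ) (m : ℕ) (α : ℝ) (ι : Type) (_ : Countable ι) (a : ι → ℝ),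
      0 ≤ α ∧ (∀ j, 0 < a j) ∧ Summable (fun j => (a j)⁻¹) ∧
      ∀ z : ℂ, ∃ p : ℂ, HasProd (fun j => 1 - z / (a j : ℂ)) p ∧
        g z = (c : ℂ) * z ^ m * Complex.exp (-(α : ℂ) * z) * p}

/-- The class `LP(S₀)*` of the real entire functions `P g` with `P` a real polynomial and
`g ∈ LP(S₀)`. -/
def LPStar : Set (ℂ → ℂ) :=
  {F | IsRealEntire F ∧ ∃ (P : Polynomial ℝ), ∃ g ∈ LP, ∀ z : ℂ, F z = evalC P z * g z}

end

end PolyaAppell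

/-! The derivative of `A(f, n)` is `n A(f, n - 1)`, so `N n` is nondecreasing by Rolle. The reversed
Appell polynomials, rescaled by `z ↦ z / n`, tend to `f` coefficientwise, so everything rests on a
closure property. Let polynomials `p` with at most `B` zeros off `[0, ∞)` tend coefficientwise to
`f ≠ 0` without losing order at `0`, and factor them as `c z ^ m ∏ (1 - y z) Q` with `y ≥ 0`,
`deg Q ≤ B` and `Q 0 = 1`. The inverse roots stay bounded: if the largest one of `Q` escaped
to infinity, rescaling it to `1` would produce polynomials that tend to the constant `1` but vanish
at `1`. Hence, along an ultrafilter, `Q` tends to a polynomial with at most `B` roots and the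
products tend to an element of `LP` without zeros off `[0, ∞)`.

This closure property gives (3) and `N ≤ sup N n`. It also makes the count lower semicontinuous, and
`N n ≤ N` follows by approximating `F` by polynomials, since for a polynomial `p` the dilation
`p (M z)` is itself a reversed Appell polynomial of a series close to `p`. -/

namespace PolyaAppell

open Polynomial Filter Topology
open scoped PowerSeries.WithPiTopology

/-! ### Polynomials and their nonnegative roots -/

/-- The number of complex roots outside `[0, ∞)`, with multiplicity: the degree minus the number of
nonnegative real roots. It is `0` for the zero polynomial. -/
noncomputable def outerCount (p : ℝ[X]) : ℕ :=
  p.natDegree - Multiset.card (p.roots.filter (0 ≤ ·))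

/-- The polynomial `∏ (1 - y X)` whose roots are the inverses of the nonzero elements of a
multiset. Listing inverse roots lets roots run off to infinity by `y → 0`. -/
noncomputable def invProd {R : Type*} [CommRing R] (s : Multiset R) : R[X] :=
  (s.map fun y => 1 - C y * X).prod

section InvProd

variable {R : Type*} [CommRing R]

theorem invProd_zero : invProd (0 : Multiset R) = 1 := by simp [invProd]

theorem invProd_cons (y : R) (s : Multiset R) :
    invProd (y ::ₘ s) = (1 - C y * X) * invProd s := by simp [invProd]

theorem invProd_add (s t : Multiset R) : invProd (s + t) = invProd s * invProd t := by
  simp [invProd]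

theorem map_invProd {S : Type*} [CommRing S] (φ : R →+* S) (s : Multiset R) :
    (invProd s).map φ = invProd (s.map φ) := by
  induction s using Multiset.induction_on with
  | empty => simp [invProd_zero]
  | cons y s ih => simp [invProd_cons, ih]

theorem coeff_zero_invProd (s : Multiset R) : (invProd s).coeff 0 = 1 := by
  induction s using Multiset.induction_on with
  | empty => simp [invProd_zero]
  | cons y s ih => simp [invProd_cons, mul_coeff_zero, ih]

theorem coeff_one_invProd (s : Multiset R) : (invProd s).coeff 1 = -s.sum := by
  induction s using Multiset.induction_on with
  | empty => simp [invProd_zero, coeff_one]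
  | cons y s ih => simp [invProd_cons, sub_mul, mul_assoc, coeff_zero_invProd, ih]; ring

theorem invProd_ne_zero [Nontrivial R] (s : Multiset R) : invProd s ≠ 0 := fun h => by
  simpa [h] using coeff_zero_invProd s

theorem reflect_reflect (N : ℕ) (p : R[X]) : (p.reflect N).reflect N = p := by
  ext; simp

theorem reflect_prod_X_sub_C (t : Multiset R) :
    (t.map fun a => X - C a).prod.reflect (Multiset.card t) = invProd t := by
  nontriviality R
  induction t using Multiset.induction_on with
  | empty => simp [invProd_zero]
  | cons a t ih =>
    rw [Multiset.map_cons, Multiset.prod_cons, Multiset.card_cons, add_comm, reflect_mul _ _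
      (natDegree_X_sub_C a).le (natDegree_multiset_prod_X_sub_C_eq_card t).le, ih, invProd_cons,
      reflect_sub, reflect_one_X, reflect_C, pow_one]

theorem exists_eq_invProd {K : Type*} [Field K] [IsAlgClosed K] {q : K[X]} (hq : q.coeff 0 = 1) :
    ∃ U : Multiset K, Multiset.card U = q.natDegree ∧ q = invProd U := by
  set r := q.reflect q.natDegree with hr
  have hle : r.natDegree ≤ q.natDegree := by
    simpa using natDegree_reflect_le (N := q.natDegree) (p := q)
  have hcoeff : r.coeff q.natDegree = 1 := by rw [hr, coeff_reflect, revAt_le le_rfl]; simpa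
  have hdeg : r.natDegree = q.natDegree :=
    hle.antisymm (le_natDegree_of_ne_zero (by rw [hcoeff]; exact one_ne_zero))
  have hmonic : r.Monic := by rw [Monic, leadingCoeff, hdeg, hcoeff]
  have hcard : Multiset.card r.roots = q.natDegree :=
    hdeg ▸ (IsAlgClosed.splits r).natDegree_eq_card_roots.symm
  refine ⟨r.roots, hcard, ?_⟩
  calc q = r.reflect q.natDegree := (reflect_reflect _ _).symm
    _ = (r.roots.map fun a => X - C a).prod.reflect (Multiset.card r.roots) := by
      rw [hcard, ← (IsAlgClosed.splits r).eq_prod_roots_of_monic hmonic]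
    _ = invProd r.roots := reflect_prod_X_sub_C _

end InvProd

theorem card_filter_roots_le_natDegree (p : ℝ[X]) (q : ℝ → Prop) [DecidablePred q] :
    Multiset.card (p.roots.filter q) ≤ p.natDegree :=
  (Multiset.card_le_card (Multiset.filter_le _ _)).trans p.card_roots'

/-- Between consecutive distinct roots of `p` lies a root of the derivative that is not a root of
`p`, and a root of multiplicity `k` of `p` is one of multiplicity at least `k - 1` of the
derivative. -/
theorem card_filter_roots_le_derivative {S : Set ℝ} [DecidablePred (· ∈ S)] (hS : S.OrdConnected)
    (p : ℝ[X]) :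
    Multiset.card (p.roots.filter (· ∈ S)) ≤
      Multiset.card ((derivative p).roots.filter (· ∈ S)) + 1 := by
  rcases eq_or_ne (derivative p) 0 with hp' | hp'
  · rw [eq_C_of_derivative_eq_zero hp']
    simp
  have hp : p ≠ 0 := ne_of_apply_ne derivative (by rwa [derivative_zero])
  set r := p.roots.filter (· ∈ S) with hr
  set r' := (derivative p).roots.filter (· ∈ S) with hr'
  have interleaved : r.toFinset.card ≤ (r'.toFinset \ r.toFinset).card + 1 := by
    refine Finset.card_le_sdiff_of_interleaved fun x hx y hy hxy _ => ?_
    rw [Multiset.mem_toFinset, Multiset.mem_filter, mem_roots hp] at hx hy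
    obtain ⟨z, hz, hz0⟩ := exists_deriv_eq_zero hxy p.continuousOn (hx.1.trans hy.1.symm)
    refine ⟨z, ?_, hz⟩
    rw [Multiset.mem_toFinset, Multiset.mem_filter, mem_roots hp', IsRoot, ← p.deriv]
    exact ⟨hz0, hS.out hx.2 hy.2 (Set.Ioo_subset_Icc_self hz)⟩
  have le_roots : r - r.dedup + (r'.toFinset \ r.toFinset).val ≤ r' := by
    refine Multiset.le_iff_count.2 fun x => ?_
    rw [Multiset.count_add, Multiset.count_sub]
    by_cases hx : x ∈ r
    · have hxS : x ∈ S := (Multiset.mem_filter.1 hx).2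
      have hx' : x ∉ (r'.toFinset \ r.toFinset).val := fun h =>
        (Finset.mem_sdiff.1 h).2 (Multiset.mem_toFinset.2 hx)
      rw [Multiset.count_dedup, if_pos hx, Multiset.count_eq_zero_of_notMem hx', add_zero, hr,
        hr', Multiset.count_filter_of_pos hxS, Multiset.count_filter_of_pos hxS, count_roots,
        count_roots]
      exact rootMultiplicity_sub_one_le_derivative_rootMultiplicity p x
    · rw [Multiset.count_eq_zero_of_notMem hx, zero_tsub, zero_add]
      exact Multiset.le_iff_count.1 (Multiset.le_iff_subset (Finset.nodup _) |>.2 fun y hy =>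
        Multiset.mem_toFinset.1 (Finset.mem_sdiff.1 hy).1) x
  have card_le := Multiset.card_le_card le_roots
  rw [Multiset.card_add, Multiset.card_sub r.dedup_le] at card_le
  have := Multiset.card_le_card r.dedup_le
  rw [Finset.card_def, Multiset.toFinset_val, Finset.card_def] at interleaved
  omega

theorem outerCount_derivative_le (p : ℝ[X]) : outerCount (derivative p) ≤ outerCount p := by
  have rolle := card_filter_roots_le_derivative (S := Set.Ici 0) Set.ordConnected_Ici p
  simp only [Set.mem_Ici] at rolle
  have hdeg := natDegree_derivative_le p
  have hcard := card_filter_roots_le_natDegree (derivative p) (0 ≤ ·)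
  rcases Nat.eq_zero_or_pos p.natDegree with h | h
  · simp [outerCount, derivative_of_natDegree_zero h]
  · unfold outerCount
    omega

theorem outerCount_le_natDegree (p : ℝ[X]) : outerCount p ≤ p.natDegree := Nat.sub_le _ _

theorem outerCount_zero : outerCount 0 = 0 := by simp [outerCount]

theorem outerCount_mul {p q : ℝ[X]} (hp : p ≠ 0) (hq : q ≠ 0) :
    outerCount (p * q) = outerCount p + outerCount q := by
  have hcp := card_filter_roots_le_natDegree p (0 ≤ ·)
  have hcq := card_filter_roots_le_natDegree q (0 ≤ ·)
  rw [outerCount, natDegree_mul hp hq, roots_mul (mul_ne_zero hp hq), Multiset.filter_add,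
    Multiset.card_add, outerCount, outerCount]
  omega

theorem outerCount_C_mul {c : ℝ} (hc : c ≠ 0) (p : ℝ[X]) :
    outerCount (C c * p) = outerCount p := by
  rw [outerCount, natDegree_C_mul hc, roots_C_mul _ hc, outerCount]

theorem outerCount_X_pow (m : ℕ) : outerCount (X ^ m) = 0 := by
  simp [outerCount, Multiset.filter_nsmul, Multiset.filter_singleton]

theorem outerCount_one_sub_C_mul_X {y : ℝ} (hy : 0 ≤ y) : outerCount (1 - C y * X) = 0 := by
  rcases hy.eq_or_lt with rfl | hy
  · simp [outerCount]
  have hdeg : (1 - C y * X).natDegree ≤ 1 := by compute_degree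
  have hne : (1 - C y * X) ≠ 0 := fun h => by simpa using congrArg (coeff · 0) h
  have hroot : y⁻¹ ∈ (1 - C y * X).roots.filter (0 ≤ ·) := by
    rw [Multiset.mem_filter, mem_roots hne]
    exact ⟨by simp [hy.ne'], (inv_pos.2 hy).le⟩
  have := Multiset.card_pos_iff_exists_mem.2 ⟨_, hroot⟩
  unfold outerCount
  omega

theorem outerCount_invProd {s : Multiset ℝ} (hs : ∀ y ∈ s, 0 ≤ y) : outerCount (invProd s) = 0 := by
  induction s using Multiset.induction_on with
  | empty => simpa [invProd_zero] using outerCount_X_pow 0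
  | cons y s ih =>
    have hne : (1 - C y * X) ≠ 0 := fun h => by simpa using congrArg (coeff · 0) h
    rw [invProd_cons, outerCount_mul hne (invProd_ne_zero s),
      outerCount_one_sub_C_mul_X (hs y (Multiset.mem_cons_self y s)),
      ih fun z hz => hs z (Multiset.mem_cons_of_mem hz)]

theorem outerCount_comp_C_mul_X {c : ℝ} (hc : 0 < c) (p : ℝ[X]) :
    outerCount (p.comp (C c * X)) = outerCount p := by
  have hroots : (p.comp (C c * X)).roots.map (c * ·) = p.roots := by
    simpa using map_roots_comp_C_mul_X_add_C p c 0 hc.ne'.isUnit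
  have hfilter : Multiset.card (p.roots.filter (0 ≤ ·)) =
      Multiset.card ((p.comp (C c * X)).roots.filter (0 ≤ ·)) := by
    rw [← hroots, Multiset.filter_map, Multiset.card_map]
    simp only [Function.comp_def, mul_nonneg_iff_of_pos_left hc]
  rw [outerCount, natDegree_comp, natDegree_C_mul_X c hc.ne', mul_one, ← hfilter, outerCount]

theorem exists_eq_prod_X_sub_C_mul {p : ℝ[X]} (hp : p ≠ 0) :
    ∃ (t : Multiset ℝ) (Q : ℝ[X]), (∀ a ∈ t, 0 ≤ a) ∧ Q.natDegree = outerCount p ∧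
      p.natDegree = Multiset.card t + Q.natDegree ∧ p = (t.map fun a => X - C a).prod * Q := by
  obtain ⟨Q, hQ⟩ := (Multiset.prod_X_sub_C_dvd_iff_le_roots hp _).2
    (Multiset.filter_le (0 ≤ ·) p.roots)
  have hdeg : p.natDegree = Multiset.card (p.roots.filter (0 ≤ ·)) + Q.natDegree := by
    conv_lhs => rw [hQ, natDegree_mul (left_ne_zero_of_mul (hQ ▸ hp))
      (right_ne_zero_of_mul (hQ ▸ hp)), natDegree_multiset_prod_X_sub_C_eq_card]
  exact ⟨_, Q, fun a ha => (Multiset.mem_filter.1 ha).2, by rw [outerCount]; omega, hdeg, hQ⟩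

theorem exists_reflect_eq_invProd_mul {p : ℝ[X]} (hp : p ≠ 0) {n : ℕ} (hn : p.natDegree ≤ n) :
    ∃ (e : ℕ) (s : Multiset ℝ) (Q : ℝ[X]), (∀ y ∈ s, 0 ≤ y) ∧ Q.coeff 0 ≠ 0 ∧
      Q.natDegree ≤ outerCount p ∧ p.reflect n = X ^ e * (invProd s * Q) := by
  obtain ⟨t, Q, ht, hQp, hdeg, hp_eq⟩ := exists_eq_prod_X_sub_C_mul hp
  have hQ : Q ≠ 0 := right_ne_zero_of_mul (hp_eq ▸ hp)
  obtain ⟨e, rfl⟩ := Nat.exists_eq_add_of_le' (hdeg ▸ hn)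
  refine ⟨e, t, Q.reflect Q.natDegree, ht, ?_, ?_, ?_⟩
  · rw [coeff_reflect, revAt_zero]
    exact leadingCoeff_ne_zero.2 hQ
  · simpa [← hQp] using natDegree_reflect_le (N := Q.natDegree) (p := Q)
  · rw [← one_mul p, reflect_mul _ _ (by simp) hdeg.le, reflect_one, hp_eq,
      reflect_mul _ _ (natDegree_multiset_prod_X_sub_C_eq_card t).le le_rfl, reflect_prod_X_sub_C]

theorem outerCount_X_pow_mul_invProd_mul (m : ℕ) {s : Multiset ℝ} (hs : ∀ y ∈ s, 0 ≤ y)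
    {Q : ℝ[X]} (hQ : Q ≠ 0) : outerCount (X ^ m * (invProd s * Q)) = outerCount Q := by
  rw [outerCount_mul (pow_ne_zero m X_ne_zero) (mul_ne_zero (invProd_ne_zero s) hQ),
    outerCount_mul (invProd_ne_zero s) hQ, outerCount_X_pow, outerCount_invProd hs]
  omega

theorem outerCount_reflect {p : ℝ[X]} {n : ℕ} (hn : p.natDegree ≤ n) :
    outerCount (p.reflect n) = outerCount p := by
  have reflect_le {p : ℝ[X]} (hn : p.natDegree ≤ n) : outerCount (p.reflect n) ≤ outerCount p := by
    rcases eq_or_ne p 0 with rfl | hp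
    · rw [reflect_zero]
    obtain ⟨e, s, Q, hs, hQ0, hdeg, h⟩ := exists_reflect_eq_invProd_mul hp hn
    have hQ : Q ≠ 0 := by rintro rfl; exact hQ0 (coeff_zero 0)
    rw [h, outerCount_X_pow_mul_invProd_mul e hs hQ]
    exact (outerCount_le_natDegree Q).trans hdeg
  refine (reflect_le hn).antisymm ?_
  conv_lhs => rw [← reflect_reflect n p]
  exact reflect_le (natDegree_reflect_le.trans (max_eq_left hn).le)

theorem exists_eq_C_mul_X_pow_mul_invProd_mul (p : ℝ[X]) :
    ∃ (c : ℝ) (m : ℕ) (s : Multiset ℝ) (Q : ℝ[X]), (∀ y ∈ s, 0 ≤ y) ∧ Q.coeff 0 = 1 ∧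
      Q.natDegree ≤ outerCount p ∧ p = C c * X ^ m * (invProd s * Q) := by
  rcases eq_or_ne p 0 with rfl | hp
  · exact ⟨0, 0, 0, 1, by simp, by simp, by simp, by simp⟩
  set n := p.natDegree
  have hn : (p.reflect n).natDegree ≤ n := natDegree_reflect_le.trans (max_self n).le
  obtain ⟨m, s, Q, hs, hQ0, hdeg, h⟩ :=
    exists_reflect_eq_invProd_mul (by rwa [Ne, reflect_eq_zero_iff]) hn
  rw [outerCount_reflect le_rfl] at hdeg
  refine ⟨Q.coeff 0, m, s, C (Q.coeff 0)⁻¹ * Q, hs, by simp [hQ0],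
    (natDegree_C_mul_le _ _).trans hdeg, ?_⟩
  have hC : (C (Q.coeff 0) * C (Q.coeff 0)⁻¹ : ℝ[X]) = 1 := by
    rw [← C_mul, mul_inv_cancel₀ hQ0, C_1]
  calc p = X ^ m * (invProd s * Q) := by rw [← h, reflect_reflect]
    _ = _ := by linear_combination (-X ^ m * invProd s * Q) * hC

/-! ### Zeros of entire functions outside `[0, ∞)` -/

theorem evalC_eq_eval (P : ℝ[X]) (z : ℂ) : evalC P z = (P.map Complex.ofRealHom).eval z := by
  rw [evalC, aeval_def, eval_map]
  rfl

theorem evalC_mul (P Q : ℝ[X]) (z : ℂ) : evalC (P * Q) z = evalC P z * evalC Q z := by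
  simp [evalC]

theorem differentiable_evalC (P : ℝ[X]) : Differentiable ℂ (evalC P) := by
  rw [funext (evalC_eq_eval P)]
  exact Polynomial.differentiable _

theorem map_ofReal_ne_zero {P : ℝ[X]} (hP : P ≠ 0) : P.map Complex.ofRealHom ≠ 0 :=
  (Polynomial.map_ne_zero_iff Complex.ofRealHom.injective).2 hP

theorem analyticOrderAt_evalC {P : ℝ[X]} (hP : P ≠ 0) (z : ℂ) :
    analyticOrderAt (evalC P) z = ((P.map Complex.ofRealHom).roots.count z : ℕ) := by
  obtain ⟨q, hq, hdvd⟩ := exists_eq_pow_rootMultiplicity_mul_and_not_dvd _ (map_ofReal_ne_zero hP) z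
  rw [count_roots, ((differentiable_evalC P).analyticAt z).analyticOrderAt_eq_natCast]
  refine ⟨fun w => q.eval w, q.differentiable.analyticAt z, mt dvd_iff_isRoot.2 hdvd,
    Eventually.of_forall fun w => ?_⟩
  rw [evalC_eq_eval]
  conv_lhs => rw [hq]
  simp

theorem mem_S₀_iff {z : ℂ} : z ∈ S₀ ↔ ∃ x : ℝ, 0 ≤ x ∧ (x : ℂ) = z := by
  constructor
  · rintro ⟨hre, him⟩
    exact ⟨z.re, hre, Complex.ext rfl him.symm⟩
  · rintro ⟨x, hx, rfl⟩
    exact ⟨hx, Complex.ofReal_im x⟩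

open Classical in
theorem card_filter_compl_S₀_roots (P : ℝ[X]) :
    Multiset.card ((P.map Complex.ofRealHom).roots.filter (· ∈ S₀ᶜ)) = outerCount P := by
  set R := (P.map Complex.ofRealHom).roots
  have mem_range {z : ℂ} (hz : z ∈ S₀) : z ∈ Complex.ofRealHom.range :=
    let ⟨x, _, hx⟩ := mem_S₀_iff.1 hz; ⟨x, hx⟩
  have filter_S₀ : R.filter (· ∈ S₀) = (P.roots.filter (0 ≤ ·)).map Complex.ofRealHom := by
    calc R.filter (· ∈ S₀) = (R.filter (· ∈ Complex.ofRealHom.range)).filter (· ∈ S₀) := by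
          rw [Multiset.filter_filter]
          exact Multiset.filter_congr fun z _ => ⟨fun h => ⟨h, mem_range h⟩, And.left⟩
      _ = (P.roots.map Complex.ofRealHom).filter (· ∈ S₀) := by
          rw [filter_roots_map_range_eq_map_roots Complex.ofRealHom.injective]
      _ = _ := by
          rw [Multiset.filter_map]
          exact congrArg _ (Multiset.filter_congr fun x _ => by simp [S₀])
  have card_R : Multiset.card R = P.natDegree := by
    rw [← (IsAlgClosed.splits _).natDegree_eq_card_roots, natDegree_map]
  have := congrArg Multiset.card (Multiset.filter_add_not (· ∈ S₀) R)
  rw [Multiset.card_add, filter_S₀, Multiset.card_map, card_R] at this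
  simp only [Set.mem_compl_iff, outerCount]
  omega

theorem summable_enat {ι : Type*} (f : ι → ℕ∞) : Summable f :=
  ⟨_, hasSum_of_isLUB _ isLUB_iSup⟩

theorem tsum_count_eq_card_filter {α : Type*} [DecidableEq α] (R : Multiset α) (T : Set α)
    [DecidablePred (· ∈ T)] :
    ∑' z : T, ((R.count (z : α) : ℕ) : ℕ∞) = Multiset.card (R.filter (· ∈ T)) := by
  rw [tsum_eq_sum (s := R.toFinset.subtype (· ∈ T)) fun z hz => by simpa using hz,
    ← Nat.cast_sum, Finset.sum_subtype_eq_sum_filter (fun z => R.count z),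
    ← Multiset.toFinset_sum_count_eq, Multiset.toFinset_filter]
  exact congrArg _ (Finset.sum_congr rfl fun z hz =>
    (Multiset.count_filter_of_pos (Finset.mem_filter.1 hz).2).symm)

theorem tsum_analyticOrderAt_evalC {P : ℝ[X]} (hP : P ≠ 0) :
    ∑' z : (S₀ᶜ : Set ℂ), analyticOrderAt (evalC P) (z : ℂ) = outerCount P := by
  classical
  rw [tsum_congr fun z : (S₀ᶜ : Set ℂ) => analyticOrderAt_evalC hP z, tsum_count_eq_card_filter,
    ← card_filter_compl_S₀_roots]

section EvalCMul

variable {G : ℂ → ℂ} (hG : Differentiable ℂ G) {P : ℝ[X]}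
include hG

theorem analyticOrderAt_evalC_mul (z : ℂ) :
    analyticOrderAt (fun w => evalC P w * G w) z =
      analyticOrderAt (evalC P) z + analyticOrderAt G z :=
  analyticOrderAt_mul ((differentiable_evalC P).analyticAt z) (hG.analyticAt z)

theorem outerCount_le_zeroCount_evalC_mul (hne : (fun z => evalC P z * G z) ≠ 0) :
    outerCount P ≤ zeroCount (fun z => evalC P z * G z) S₀ᶜ := by
  have hP : P ≠ 0 := by
    rintro rfl
    exact hne (funext fun z => by simp [evalC])
  rw [zeroCount, if_neg hne, ← tsum_analyticOrderAt_evalC hP]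
  refine (summable_enat _).tsum_le_tsum (fun z => ?_) (summable_enat _)
  rw [analyticOrderAt_evalC_mul hG]
  exact le_self_add

theorem zeroCount_evalC_mul (hP : P ≠ 0) (hG0 : ∀ z ∈ S₀ᶜ, G z ≠ 0) :
    zeroCount (fun z => evalC P z * G z) S₀ᶜ = outerCount P := by
  have order_eq (z : ℂ) (hz : z ∈ S₀ᶜ) :
      analyticOrderAt (fun w => evalC P w * G w) z = analyticOrderAt (evalC P) z := by
    rw [analyticOrderAt_evalC_mul hG, (hG.analyticAt z).analyticOrderAt_eq_zero.2 (hG0 z hz),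
      add_zero]
  have hne : (fun z => evalC P z * G z) ≠ 0 := fun h => by
    have := order_eq (-1) (by simp [S₀])
    rw [h, analyticOrderAt_evalC hP] at this
    exact ENat.natCast_ne_top _ (this.symm.trans (analyticOrderAt_eq_top.2 (by simp)))
  rw [zeroCount, if_neg hne, ← tsum_analyticOrderAt_evalC hP]
  exact tsum_congr fun z => order_eq z z.2

end EvalCMul

theorem zeroCount_evalC (P : ℝ[X]) : zeroCount (evalC P) S₀ᶜ = outerCount P := by
  rcases eq_or_ne P 0 with rfl | hP
  · have : evalC 0 = 0 := funext fun z => by simp [evalC]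
    simp [this, zeroCount, outerCount_zero]
  · simpa using zeroCount_evalC_mul (differentiable_const (1 : ℂ)) hP (by simp)

/-! ### Appell and Jensen polynomials -/

theorem derivative_appell (f : PowerSeries ℝ) (n : ℕ) :
    derivative (appell f (n + 1)) = C ((n : ℝ) + 1) * appell f n := by
  rw [appell, appell, Finset.sum_range_succ, derivative_add, derivative_sum, Finset.mul_sum]
  simp only [Nat.sub_self, derivative_monomial, Nat.cast_zero, mul_zero, monomial_zero_right,
    add_zero]
  refine Finset.sum_congr rfl fun k hk => ?_
  obtain ⟨d, rfl⟩ := Nat.exists_eq_add_of_le (Nat.lt_succ_iff.1 (Finset.mem_range.1 hk))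
  rw [C_mul_monomial, show k + d + 1 - k = d + 1 by omega, Nat.add_sub_cancel_left,
    Nat.add_sub_cancel]
  congr 1
  rw [Nat.factorial_succ, Nat.factorial_succ]
  have := Nat.factorial_ne_zero d
  push_cast
  field_simp

theorem monotone_outerCount_appell (f : PowerSeries ℝ) :
    Monotone fun n => outerCount (appell f n) :=
  monotone_nat_of_le_succ fun n => by
    rw [← outerCount_C_mul (show (n : ℝ) + 1 ≠ 0 by positivity), ← derivative_appell]
    exact outerCount_derivative_le _

theorem natDegree_appell_le (f : PowerSeries ℝ) (n : ℕ) : (appell f n).natDegree ≤ n :=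
  natDegree_sum_le_of_forall_le _ _ fun k _ => (natDegree_monomial_le _).trans (Nat.sub_le n k)

theorem appell_zero (n : ℕ) : appell 0 n = 0 := by simp [appell]

theorem appellCount_eq (f : PowerSeries ℝ) (n : ℕ) :
    appellCount f n = outerCount (appell f n) := zeroCount_evalC _

theorem appellCount_zero (f : PowerSeries ℝ) : appellCount f 0 = 0 := by
  rw [appellCount_eq, Nat.cast_eq_zero, ← Nat.le_zero]
  exact (outerCount_le_natDegree _).trans (natDegree_appell_le f 0)

theorem appellCount_le_succ (f : PowerSeries ℝ) (n : ℕ) :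
    appellCount f n ≤ appellCount f (n + 1) := by
  rw [appellCount_eq, appellCount_eq, Nat.cast_le]
  exact monotone_outerCount_appell f n.le_succ

/-- The `n`-th Jensen polynomial `∑ k, n (n - 1) ⋯ (n - k + 1) a_k X ^ k` of `f = ∑ a_k X ^ k`, the
reversal of the `n`-th Appell polynomial. -/
noncomputable def jensen (f : PowerSeries ℝ) (n : ℕ) : ℝ[X] := (appell f n).reflect n

theorem coeff_jensen (f : PowerSeries ℝ) (n k : ℕ) :
    (jensen f n).coeff k = n.descFactorial k * PowerSeries.coeff k f := by
  rw [jensen, coeff_reflect, appell, finsetSum_coeff]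
  simp only [coeff_monomial]
  rcases le_or_gt k n with hk | hk
  · rw [revAt_le hk, Finset.sum_eq_single_of_mem k (Finset.mem_range.2 (by omega)), if_pos rfl,
      Nat.descFactorial_eq_div hk, Nat.cast_div (Nat.factorial_dvd_factorial (Nat.sub_le n k))
        (by exact_mod_cast Nat.factorial_ne_zero _)]
    intro j hj hjk
    rw [Finset.mem_range] at hj
    exact if_neg (by omega)
  · rw [revAt_eq_self_of_lt hk, Nat.descFactorial_of_lt hk, Nat.cast_zero, zero_mul]
    exact Finset.sum_eq_zero fun j _ => if_neg (by omega)

theorem outerCount_jensen (f : PowerSeries ℝ) (n : ℕ) :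
    outerCount (jensen f n) = outerCount (appell f n) :=
  outerCount_reflect (natDegree_appell_le f n)

theorem tendsto_descFactorial_div_pow (k : ℕ) :
    Tendsto (fun n : ℕ => (n.descFactorial k : ℝ) / (n : ℝ) ^ k) atTop (𝓝 1) :=
  (Asymptotics.isEquivalent_iff_tendsto_one ((eventually_gt_atTop 0).mono fun n hn => by
    positivity)).1 (isEquivalent_descFactorial k)

theorem tendsto_jensen_comp (f : PowerSeries ℝ) :
    Tendsto (fun n : ℕ => ((jensen f n).comp (C (n : ℝ)⁻¹ * X) : PowerSeries ℝ)) atTop (𝓝 f) := by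
  refine (PowerSeries.WithPiTopology.tendsto_iff_coeff_tendsto ℝ _ _ _).2 fun k => ?_
  have := (tendsto_descFactorial_div_pow k).mul_const (PowerSeries.coeff k f)
  rw [one_mul] at this
  refine this.congr fun n => ?_
  rw [coeff_coe, comp_C_mul_X_coeff, coeff_jensen, inv_pow]
  ring

/-! ### Entire power series and limits of polynomials -/

theorem Represents.hasFPowerSeriesOnBall {f : PowerSeries ℝ} {F : ℂ → ℂ} (hf : Represents f F) :
    HasFPowerSeriesOnBall F
      (FormalMultilinearSeries.ofScalars ℂ fun k => ((PowerSeries.coeff k f : ℝ) : ℂ)) 0 ⊤ where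
  r_le := by
    refine ENNReal.le_of_forall_nnreal_lt fun r _ =>
      FormalMultilinearSeries.le_radius_of_summable _ ((hf r).summable.norm.congr fun k => ?_)
    rw [FormalMultilinearSeries.ofScalars_norm]
    simp
  r_pos := by simp
  hasSum := fun {z} _ => by
    rw [zero_add]
    simpa [FormalMultilinearSeries.ofScalars_apply_eq, mul_comm] using hf z

theorem Represents.differentiable {f : PowerSeries ℝ} {F : ℂ → ℂ} (hf : Represents f F) :
    Differentiable ℂ F := by
  simpa [differentiableOn_univ] using hf.hasFPowerSeriesOnBall.differentiableOn

theorem Represents.isRealEntire {f : PowerSeries ℝ} {F : ℂ → ℂ} (hf : Represents f F) :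
    IsRealEntire F := by
  refine ⟨hf.differentiable, fun x => (Complex.hasSum_im (hf x)).unique ?_⟩
  simp_rw [← Complex.ofReal_pow, ← Complex.ofReal_mul, Complex.ofReal_im]
  exact hasSum_zero

theorem Represents.unique {f : PowerSeries ℝ} {F G : ℂ → ℂ} (hF : Represents f F)
    (hG : Represents f G) : F = G := funext fun z => (hF z).unique (hG z)

theorem Represents.coeff_unique {f g : PowerSeries ℝ} {F : ℂ → ℂ} (hf : Represents f F)
    (hg : Represents g F) : f = g := by
  have := FormalMultilinearSeries.ofScalars_series_injective (𝕜 := ℂ) ℂ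
    (hf.hasFPowerSeriesOnBall.hasFPowerSeriesAt.eq_formalMultilinearSeries
      hg.hasFPowerSeriesOnBall.hasFPowerSeriesAt)
  ext k
  exact_mod_cast congrFun this k

theorem represents_zero : Represents 0 0 := fun z => by simp

theorem represents_coe (P : ℝ[X]) : Represents P (evalC P) := fun z => by
  rw [evalC, aeval_eq_sum_range]
  simp only [coeff_coe, Complex.real_smul]
  refine hasSum_sum_of_ne_finset_zero fun k hk => ?_
  rw [coeff_eq_zero_of_natDegree_lt (by simpa using hk), Complex.ofReal_zero, zero_mul]

theorem Represents.mul {f g : PowerSeries ℝ} {F G : ℂ → ℂ} (hf : Represents f F)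
    (hg : Represents g G) : Represents (f * g) fun z => F z * G z := fun z => by
  have hfz := (hf z).summable.norm
  have hgz := (hg z).summable.norm
  have hterm (k : ℕ) : ((PowerSeries.coeff k (f * g) : ℝ) : ℂ) * z ^ k =
      ∑ kl ∈ Finset.HasAntidiagonal.antidiagonal k,
        ((PowerSeries.coeff kl.1 f : ℝ) : ℂ) * z ^ kl.1 *
          (((PowerSeries.coeff kl.2 g : ℝ) : ℂ) * z ^ kl.2) := by
    rw [PowerSeries.coeff_mul, Complex.ofReal_sum, Finset.sum_mul]
    refine Finset.sum_congr rfl fun kl hkl => ?_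
    rw [← Finset.HasAntidiagonal.mem_antidiagonal.1 hkl, pow_add]
    push_cast
    ring
  beta_reduce
  rw [← (hf z).tsum_eq, ← (hg z).tsum_eq,
    tsum_mul_tsum_eq_tsum_sum_antidiagonal_of_summable_norm hfz hgz]
  simp_rw [hterm]
  exact (summable_norm_sum_mul_antidiagonal_of_summable_norm hfz hgz).of_norm.hasSum

theorem summable_pow_div_factorial_mul_pow (S r : ℝ) :
    Summable fun k : ℕ => S ^ k / (k.factorial : ℝ) * r ^ k := by
  refine (Real.summable_pow_div_factorial (S * r)).congr fun k => ?_
  rw [mul_pow, div_mul_eq_mul_div]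

theorem tendsto_eval_of_dominated {ι 𝕜 : Type*} [NormedField 𝕜] [CompleteSpace 𝕜] {l : Filter ι}
    {p : ι → 𝕜[X]} {b : ℕ → 𝕜} {u : ℕ → ℝ} {z : 𝕜} (hu : Summable fun k => u k * ‖z‖ ^ k)
    (hp : ∀ᶠ i in l, ∀ k, ‖(p i).coeff k‖ ≤ u k)
    (hb : ∀ k, Tendsto (fun i => (p i).coeff k) l (𝓝 (b k))) :
    Tendsto (fun i => (p i).eval z) l (𝓝 (∑' k, b k * z ^ k)) := by
  have eval_eq_tsum (q : 𝕜[X]) : q.eval z = ∑' k, q.coeff k * z ^ k := by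
    rw [eval_eq_sum_range, tsum_eq_sum]
    intro k hk
    rw [coeff_eq_zero_of_natDegree_lt (by simpa using hk), zero_mul]
  simp_rw [eval_eq_tsum]
  refine tendsto_tsum_of_dominated_convergence hu (fun k => (hb k).mul_const _)
    (hp.mono fun i hi k => ?_)
  rw [norm_mul, norm_pow]
  gcongr
  exact hi k

theorem tendsto_coeff {ι : Type*} {l : Filter ι} {p : ι → ℝ[X]} {f : PowerSeries ℝ}
    (h : Tendsto (fun i => (p i : PowerSeries ℝ)) l (𝓝 f)) (k : ℕ) :
    Tendsto (fun i => (p i).coeff k) l (𝓝 (PowerSeries.coeff k f)) := by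
  simpa only [coeff_coe] using (PowerSeries.WithPiTopology.tendsto_iff_coeff_tendsto ℝ _ _ _).1 h k

theorem exists_represents_of_dominated {ι : Type*} {l : Filter ι} [l.NeBot] {p : ι → ℝ[X]}
    {f : PowerSeries ℝ} {u : ℕ → ℝ} (hu : ∀ r : ℝ, Summable fun k => u k * r ^ k)
    (hp : ∀ᶠ i in l, ∀ k, |(p i).coeff k| ≤ u k)
    (hf : Tendsto (fun i => (p i : PowerSeries ℝ)) l (𝓝 f)) :
    ∃ F : ℂ → ℂ, Represents f F ∧ ∀ z, Tendsto (fun i => evalC (p i) z) l (𝓝 (F z)) := by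
  have coeff_le (k : ℕ) : |PowerSeries.coeff k f| ≤ u k :=
    le_of_tendsto (tendsto_coeff hf k).abs (hp.mono fun i hi => hi k)
  refine ⟨fun z => ∑' k, ((PowerSeries.coeff k f : ℝ) : ℂ) * z ^ k, fun z => ?_, fun z => ?_⟩
  · refine (Summable.of_norm_bounded (hu ‖z‖) fun k => ?_).hasSum
    rw [norm_mul, norm_pow, Complex.norm_real, Real.norm_eq_abs]
    gcongr
    exact coeff_le k
  · simp_rw [evalC_eq_eval]
    refine tendsto_eval_of_dominated (hu ‖z‖) (hp.mono fun i hi k => ?_) fun k => ?_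
    · simpa using hi k
    · simp_rw [coeff_map]
      exact (Complex.continuous_ofReal.tendsto _).comp (tendsto_coeff hf k)

section Ultrafilter

variable {ι : Type*} (l : Ultrafilter ι)

theorem exists_tendsto_of_abs_le {x : ι → ℝ} {D : ℝ} (h : ∀ᶠ i in l, |x i| ≤ D) :
    ∃ a, Tendsto x l (𝓝 a) := by
  obtain ⟨a, -, ha⟩ := (isCompact_Icc (a := -D) (b := D)).ultrafilter_le_nhds (l.map x)
    (le_principal_iff.2 (h.mono fun i hi => abs_le.1 hi))
  exact ⟨a, ha⟩

theorem exists_tendsto_powerSeries {p : ι → ℝ[X]} {u : ℕ → ℝ}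
    (h : ∀ k, ∀ᶠ i in l, |(p i).coeff k| ≤ u k) :
    ∃ f : PowerSeries ℝ, Tendsto (fun i => (p i : PowerSeries ℝ)) l (𝓝 f) := by
  choose b hb using fun k => exists_tendsto_of_abs_le l (h k)
  refine ⟨PowerSeries.mk b,
    (PowerSeries.WithPiTopology.tendsto_iff_coeff_tendsto ℝ _ _ _).2 fun k => ?_⟩
  simpa only [coeff_coe, PowerSeries.coeff_mk] using hb k

theorem exists_tendsto_polynomial {p : ι → ℝ[X]} {u : ℕ → ℝ}
    (h : ∀ k, ∀ᶠ i in l, |(p i).coeff k| ≤ u k) {B : ℕ} (hB : ∀ᶠ i in l, (p i).natDegree ≤ B) :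
    ∃ P : ℝ[X], P.natDegree ≤ B ∧
      Tendsto (fun i => (p i : PowerSeries ℝ)) l (𝓝 (P : PowerSeries ℝ)) := by
  obtain ⟨f, hf⟩ := exists_tendsto_powerSeries l h
  have coeff_eq_zero (k : ℕ) (hk : B < k) : PowerSeries.coeff k f = 0 :=
    tendsto_nhds_unique (tendsto_coeff hf k) (tendsto_const_nhds.congr' (hB.mono fun i hi =>
      (coeff_eq_zero_of_natDegree_lt (hi.trans_lt hk)).symm))
  refine ⟨PowerSeries.trunc (B + 1) f,
    Nat.lt_succ_iff.1 (PowerSeries.natDegree_trunc_lt f B), ?_⟩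
  convert hf
  ext k
  rw [coeff_coe, PowerSeries.coeff_trunc]
  split_ifs with hk
  · rfl
  · exact (coeff_eq_zero k (by omega)).symm

end Ultrafilter

/-! ### Tightness of the inverse roots -/

theorem sum_map_norm_nonneg {E : Type*} [SeminormedAddGroup E] (U : Multiset E) :
    0 ≤ (U.map norm).sum :=
  Multiset.sum_nonneg fun x hx => by
    obtain ⟨a, -, rfl⟩ := Multiset.mem_map.1 hx
    exact norm_nonneg a

theorem pow_succ_add_mul_le {a b : ℝ} (ha : 0 ≤ a) (hb : 0 ≤ b) (k : ℕ) :
    a ^ (k + 1) + (k + 1) * b * a ^ k ≤ (b + a) ^ (k + 1) := by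
  induction k with
  | zero => simp [add_comm]
  | succ k ih =>
    have hrest : 0 ≤ (k + 1) * b ^ 2 * a ^ k := by positivity
    calc a ^ (k + 1 + 1) + ((k + 1 : ℕ) + 1) * b * a ^ (k + 1)
        ≤ (b + a) * (a ^ (k + 1) + (k + 1) * b * a ^ k) := by
          push_cast
          linear_combination hrest
      _ ≤ (b + a) * (b + a) ^ (k + 1) := by gcongr
      _ = (b + a) ^ (k + 1 + 1) := (pow_succ' _ _).symm

theorem norm_coeff_invProd_le {𝕜 : Type*} [NormedField 𝕜] (W : Multiset 𝕜) (k : ℕ) :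
    ‖(invProd W).coeff k‖ ≤ (W.map norm).sum ^ k / (k.factorial : ℝ) := by
  induction W using Multiset.induction_on generalizing k with
  | empty => cases k <;> simp [invProd_zero, coeff_one]
  | cons w W ih =>
    rcases k with _ | k
    · simp [coeff_zero_invProd]
    set S := (W.map norm).sum
    have hcoeff : (invProd (w ::ₘ W)).coeff (k + 1) =
        (invProd W).coeff (k + 1) - w * (invProd W).coeff k := by
      rw [invProd_cons, sub_mul, one_mul, mul_assoc, coeff_sub, coeff_C_mul, coeff_X_mul]
    rw [hcoeff, Multiset.map_cons, Multiset.sum_cons]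
    calc ‖(invProd W).coeff (k + 1) - w * (invProd W).coeff k‖
        ≤ ‖(invProd W).coeff (k + 1)‖ + ‖w‖ * ‖(invProd W).coeff k‖ :=
          (norm_sub_le _ _).trans_eq (by rw [norm_mul])
      _ ≤ S ^ (k + 1) / ((k + 1).factorial : ℝ) + ‖w‖ * (S ^ k / (k.factorial : ℝ)) := by
          gcongr
          exacts [ih _, ih _]
      _ = (S ^ (k + 1) + (k + 1) * ‖w‖ * S ^ k) / ((k + 1).factorial : ℝ) := by
          have := Nat.factorial_ne_zero k
          rw [Nat.factorial_succ]
          push_cast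
          field_simp
      _ ≤ (‖w‖ + S) ^ (k + 1) / ((k + 1).factorial : ℝ) := by
          gcongr
          exact pow_succ_add_mul_le (sum_map_norm_nonneg W) (norm_nonneg w) k

theorem abs_coeff_invProd_le {s : Multiset ℝ} (hs : ∀ y ∈ s, 0 ≤ y) {S : ℝ} (hS : s.sum ≤ S)
    (k : ℕ) : |(invProd s).coeff k| ≤ S ^ k / (k.factorial : ℝ) := by
  refine (norm_coeff_invProd_le s k).trans ?_
  rw [Multiset.map_congr rfl fun y hy => Real.norm_of_nonneg (hs y hy), Multiset.map_id']
  have := Multiset.sum_nonneg hs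
  gcongr

theorem sum_norm_add_le {s : Multiset ℝ} (hs : ∀ y ∈ s, 0 ≤ y) (U : Multiset ℂ) :
    ((s.map Complex.ofReal + U).map norm).sum ≤
      ‖(invProd (s.map Complex.ofReal + U)).coeff 1‖ + 2 * (U.map norm).sum := by
  have norm_s : ((s.map Complex.ofReal).map norm).sum = ‖(s.map Complex.ofReal).sum‖ := by
    rw [Multiset.map_map, Multiset.map_congr rfl fun y hy => by
      rw [Function.comp_apply, Complex.norm_of_nonneg (hs y hy)], Multiset.map_id',
      ← Complex.norm_of_nonneg (Multiset.sum_nonneg hs)]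
    exact congrArg norm (map_multiset_sum Complex.ofRealHom s)
  have sum_s : (s.map Complex.ofReal).sum =
      -(invProd (s.map Complex.ofReal + U)).coeff 1 - U.sum := by
    rw [coeff_one_invProd, Multiset.sum_add]
    ring
  have norm_sum_s := norm_sub_le (-(invProd (s.map Complex.ofReal + U)).coeff 1) U.sum
  have norm_U := norm_multiset_sum_le U
  rw [norm_neg, ← sum_s, ← norm_s] at norm_sum_s
  rw [Multiset.map_add, Multiset.sum_add]
  linarith

/-- Rescaled so that the inverse root `w i` becomes `1`, the polynomials would converge to the
constant `1` and yet vanish at `1`. -/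
theorem not_tendsto_norm_atTop {ι : Type*} {l : Filter ι} [l.NeBot] {W : ι → Multiset ℂ}
    {w : ι → ℂ} (hw : ∀ᶠ i in l, w i ∈ W i) {D : ℝ}
    (hD : ∀ᶠ i in l, ((W i).map norm).sum ≤ D * ‖w i‖) {M : ℕ → ℝ}
    (hM : ∀ k, ∀ᶠ i in l, ‖(invProd (W i)).coeff k‖ ≤ M k) :
    ¬ Tendsto (fun i => ‖w i‖) l atTop := by
  intro hlim
  have hw0 : ∀ᶠ i in l, 0 < ‖w i‖ := hlim.eventually_gt_atTop 0
  set q : ι → ℂ[X] := fun i => (invProd (W i)).comp (C (w i)⁻¹ * X)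
  have norm_coeff (i : ι) (k : ℕ) :
      ‖(q i).coeff k‖ = ‖(invProd (W i)).coeff k‖ * ‖w i‖⁻¹ ^ k := by
    rw [comp_C_mul_X_coeff, norm_mul, norm_pow, norm_inv]
  have dominated : ∀ᶠ i in l, ∀ k, ‖(q i).coeff k‖ ≤ D ^ k / (k.factorial : ℝ) := by
    filter_upwards [hw0, hD] with i hi hDi k
    calc ‖(q i).coeff k‖ ≤ (D * ‖w i‖) ^ k / (k.factorial : ℝ) * ‖w i‖⁻¹ ^ k := by
          rw [norm_coeff]
          have := sum_map_norm_nonneg (W i)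
          gcongr
          exact (norm_coeff_invProd_le _ k).trans (by gcongr)
      _ = D ^ k / (k.factorial : ℝ) := by
          rw [mul_pow, inv_pow]
          field_simp
  have coeff_tendsto (k : ℕ) :
      Tendsto (fun i => (q i).coeff k) l (𝓝 (if k = 0 then 1 else 0)) := by
    rcases eq_or_ne k 0 with rfl | hk
    · simp [q, comp_C_mul_X_coeff, coeff_zero_invProd]
    rw [if_neg hk]
    refine squeeze_zero_norm' ((hM k).mono fun i hi => (norm_coeff i k).trans_le ?_)
      (a := fun i => M k * ‖w i‖⁻¹ ^ k) ?_
    · gcongr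
    · simpa [hk] using ((tendsto_inv_atTop_zero.comp hlim).pow k).const_mul (M k)
  have eval_tendsto := tendsto_eval_of_dominated (z := 1)
    (summable_pow_div_factorial_mul_pow D _) dominated coeff_tendsto
  have eval_eq_zero : ∀ᶠ i in l, (q i).eval 1 = 0 := by
    filter_upwards [hw, hw0] with i hi hi0
    obtain ⟨V, hV⟩ := Multiset.exists_cons_of_mem hi
    simp [q, hV, invProd_cons, norm_pos_iff.1 hi0]
  simpa using tendsto_nhds_unique eval_tendsto
    (tendsto_const_nhds.congr' (eval_eq_zero.mono fun i hi => hi.symm))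

theorem exists_norm_max {E : Type*} [NormedAddCommGroup E] (U : Multiset E) :
    ∃ w ∈ 0 ::ₘ U, (U.map norm).sum ≤ Multiset.card U * ‖w‖ := by
  classical
  obtain ⟨w, hw, hmax⟩ := (0 ::ₘ U).toFinset.exists_max_image norm ⟨0, by simp⟩
  refine ⟨w, Multiset.mem_toFinset.1 hw, ?_⟩
  have := Multiset.sum_le_card_nsmul (U.map norm) ‖w‖ fun x hx => by
    obtain ⟨v, hv, rfl⟩ := Multiset.mem_map.1 hx
    exact hmax v (by simp [hv])
  rwa [Multiset.card_map, nsmul_eq_mul] at this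

theorem exists_sum_norm_le {ι : Type*} (l : Ultrafilter ι) {s : ι → Multiset ℝ}
    (hs : ∀ i, ∀ y ∈ s i, 0 ≤ y) {U : ι → Multiset ℂ} {B : ℕ}
    (hB : ∀ᶠ i in l, Multiset.card (U i) ≤ B) {M : ℕ → ℝ}
    (hM : ∀ k, ∀ᶠ i in l, ‖(invProd ((s i).map Complex.ofReal + U i)).coeff k‖ ≤ M k) :
    ∃ S, ∀ᶠ i in l, (((s i).map Complex.ofReal + U i).map norm).sum ≤ S := by
  choose w hw hwU using fun i => exists_norm_max (U i)
  have sum_le : ∀ᶠ i in l,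
      (((s i).map Complex.ofReal + U i).map norm).sum ≤ |M 1| + 2 * (B * ‖w i‖) := by
    filter_upwards [hB, hM 1] with i hBi hMi
    calc _ ≤ _ := sum_norm_add_le (hs i) (U i)
      _ ≤ |M 1| + 2 * (B * ‖w i‖) := by
        gcongr
        · exact hMi.trans (le_abs_self _)
        · exact (hwU i).trans (by gcongr)
  have bounded : ¬ Tendsto (fun i => ‖w i‖) l atTop := fun hlim => by
    refine not_tendsto_norm_atTop (D := |M 1| + 2 * B) ?_ ?_ hM hlim
    · filter_upwards [hlim.eventually_gt_atTop 0] with i hi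
      exact Multiset.mem_add.2 (Or.inr
        ((Multiset.mem_cons.1 (hw i)).resolve_left (norm_pos_iff.1 hi)))
    · filter_upwards [sum_le, hlim.eventually_ge_atTop 1] with i hi hwi
      linarith [le_mul_of_one_le_right (abs_nonneg (M 1)) hwi]
  simp only [tendsto_atTop, not_forall] at bounded
  obtain ⟨R, hR⟩ := bounded
  refine ⟨|M 1| + 2 * (B * R), ?_⟩
  filter_upwards [sum_le, Ultrafilter.eventually_not.2 hR] with i hi hRi
  exact hi.trans (by gcongr; exact (not_le.1 hRi).le)

theorem exists_bounds_of_bounded_mul {ι : Type*} (l : Ultrafilter ι) {s : ι → Multiset ℝ}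
    (hs : ∀ i, ∀ y ∈ s i, 0 ≤ y) {Q : ι → ℝ[X]} (hQ0 : ∀ i, (Q i).coeff 0 = 1) {B : ℕ}
    (hB : ∀ᶠ i in l, (Q i).natDegree ≤ B) {M : ℕ → ℝ}
    (hM : ∀ k, ∀ᶠ i in l, |(invProd (s i) * Q i).coeff k| ≤ M k) :
    ∃ S : ℝ, (∀ᶠ i in l, (s i).sum ≤ S) ∧
      ∀ k, ∀ᶠ i in l, |(Q i).coeff k| ≤ S ^ k / (k.factorial : ℝ) := by
  choose U hcard hU using fun i =>
    exists_eq_invProd (q := (Q i).map Complex.ofRealHom) (by simp [hQ0 i])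
  have map_mul (i : ι) : (invProd (s i) * Q i).map Complex.ofRealHom =
      invProd ((s i).map Complex.ofReal + U i) := by
    rw [Polynomial.map_mul, map_invProd, hU, ← invProd_add]
    rfl
  obtain ⟨S, hS⟩ := exists_sum_norm_le l hs (U := U) (B := B) (M := M)
    (by simpa [hcard] using hB) fun k => by
      simpa only [← map_mul, coeff_map, Complex.ofRealHom_eq_coe, Complex.norm_real,
        Real.norm_eq_abs] using hM k
  have sum_add_le : ∀ᶠ i in l, (s i).sum + ((U i).map norm).sum ≤ S := by
    filter_upwards [hS] with i hi
    rwa [Multiset.map_add, Multiset.sum_add, Multiset.map_map, Multiset.map_congr rfl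
      fun y hy => by rw [Function.comp_apply, Complex.norm_of_nonneg (hs i y hy)],
      Multiset.map_id'] at hi
  refine ⟨S, ?_, fun k => ?_⟩
  · filter_upwards [sum_add_le] with i hi
    linarith [sum_map_norm_nonneg (U i)]
  · filter_upwards [sum_add_le] with i hi
    have hs_sum := Multiset.sum_nonneg (hs i)
    have hU_sum := sum_map_norm_nonneg (U i)
    calc |(Q i).coeff k| = ‖(invProd (U i)).coeff k‖ := by simp [← hU]
      _ ≤ ((U i).map norm).sum ^ k / (k.factorial : ℝ) := norm_coeff_invProd_le _ k
      _ ≤ S ^ k / (k.factorial : ℝ) := by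
        gcongr
        linarith

/-! ### Limits of products with nonnegative inverse roots -/

/-- The elements of a multiset in decreasing order, continued by zeros. Matching the inverse roots
of different polynomials by rank lets one pass to the limit in each of them separately. -/
noncomputable def decreasingEnum (s : Multiset ℝ) (j : ℕ) : ℝ := (s.sort (· ≥ ·)).getD j 0

theorem decreasingEnum_of_card_le {s : Multiset ℝ} {j : ℕ} (hj : Multiset.card s ≤ j) :
    decreasingEnum s j = 0 :=
  List.getD_eq_default _ _ (by rwa [Multiset.length_sort])

theorem decreasingEnum_eq_getElem {s : Multiset ℝ} {j : ℕ}
    (hj : j < (s.sort (· ≥ ·)).length) : decreasingEnum s j = (s.sort (· ≥ ·))[j] :=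
  List.getD_eq_getElem _ _ hj

theorem decreasingEnum_nonneg {s : Multiset ℝ} (hs : ∀ y ∈ s, 0 ≤ y) (j : ℕ) :
    0 ≤ decreasingEnum s j := by
  rcases lt_or_ge j (s.sort (· ≥ ·)).length with hj | hj
  · rw [decreasingEnum_eq_getElem hj]
    exact hs _ ((Multiset.mem_sort _).1 (List.getElem_mem hj))
  · exact (decreasingEnum_of_card_le (by rwa [Multiset.length_sort] at hj)).ge

theorem antitone_decreasingEnum {s : Multiset ℝ} (hs : ∀ y ∈ s, 0 ≤ y) :
    Antitone (decreasingEnum s) := fun i j hij => by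
  rcases lt_or_ge j (s.sort (· ≥ ·)).length with hj | hj
  · rw [decreasingEnum_eq_getElem hj, decreasingEnum_eq_getElem (hij.trans_lt hj)]
    exact (Multiset.pairwise_sort s (· ≥ ·)).sortedGE.antitone_get (a := ⟨i, hij.trans_lt hj⟩)
      (b := ⟨j, hj⟩) hij
  · rw [decreasingEnum_of_card_le (by rwa [Multiset.length_sort] at hj)]
    exact decreasingEnum_nonneg hs i

@[to_additive]
theorem hasProd_decreasingEnum {M : Type*} [CommMonoid M] [TopologicalSpace M] (s : Multiset ℝ)
    {φ : ℝ → M} (hφ : φ 0 = 1) : HasProd (fun j => φ (decreasingEnum s j)) (s.map φ).prod := by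
  have prod_eq (t : List ℝ) : (t.map φ).prod = ∏ j ∈ Finset.range t.length, φ (t.getD j 0) := by
    rw [← Fin.prod_univ_eq_prod_range (fun j => φ (t.getD j 0)), ← List.prod_ofFn]
    congr 1
    refine List.ext_getElem (by simp) fun j h₁ h₂ => ?_
    simp
  have prod_sort := prod_eq (s.sort (· ≥ ·))
  rw [← Multiset.prod_coe, ← Multiset.map_coe, Multiset.sort_eq] at prod_sort
  rw [prod_sort]
  refine hasProd_prod_of_ne_finset_one fun j hj => ?_
  rw [decreasingEnum_of_card_le (by simpa using hj), hφ]

theorem hasSum_decreasingEnum_self (s : Multiset ℝ) : HasSum (decreasingEnum s) s.sum := by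
  simpa using hasSum_decreasingEnum s (φ := id) rfl

theorem sum_decreasingEnum_le {s : Multiset ℝ} (hs : ∀ y ∈ s, 0 ≤ y) (u : Finset ℕ) :
    ∑ j ∈ u, decreasingEnum s j ≤ s.sum :=
  sum_le_hasSum u (fun j _ => decreasingEnum_nonneg hs j) (hasSum_decreasingEnum_self s)

theorem decreasingEnum_le_div {s : Multiset ℝ} (hs : ∀ y ∈ s, 0 ≤ y) {S : ℝ} (hS : s.sum ≤ S)
    (j : ℕ) : decreasingEnum s j ≤ S / (j + 1) := by
  rw [le_div_iff₀' (by positivity)]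
  calc ((j : ℝ) + 1) * decreasingEnum s j
      = ∑ _i ∈ Finset.range (j + 1), decreasingEnum s j := by simp
    _ ≤ ∑ i ∈ Finset.range (j + 1), decreasingEnum s i := Finset.sum_le_sum fun _ hi =>
        antitone_decreasingEnum hs (Nat.lt_succ_iff.1 (Finset.mem_range.1 hi))
    _ ≤ S := (sum_decreasingEnum_le hs _).trans hS

theorem evalC_invProd (s : Multiset ℝ) (z : ℂ) :
    evalC (invProd s) z = (s.map fun y : ℝ => 1 - z * (y : ℂ)).prod := by
  rw [evalC, invProd, map_multiset_prod, Multiset.map_map]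
  congr 1
  refine Multiset.map_congr rfl fun y _ => ?_
  simp only [Function.comp_apply, map_sub, map_one, map_mul, aeval_C, aeval_X,
    Complex.coe_algebraMap]
  rw [mul_comm]

theorem norm_one_sub_mul_exp_sub_one_le (w : ℂ) :
    ‖(1 - w) * Complex.exp w - 1‖ ≤ 2 * ‖w‖ ^ 2 * Real.exp ‖w‖ := by
  have h₁ : ‖Complex.exp w - 1‖ ≤ ‖w‖ * Real.exp ‖w‖ := by
    simpa using Complex.norm_exp_sub_sum_le_norm_mul_exp w 1
  have h₂ : ‖Complex.exp w - (1 + w)‖ ≤ ‖w‖ ^ 2 * Real.exp ‖w‖ := by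
    simpa [Finset.sum_range_succ] using Complex.norm_exp_sub_sum_le_norm_mul_exp w 2
  calc ‖(1 - w) * Complex.exp w - 1‖
      = ‖(Complex.exp w - (1 + w)) - w * (Complex.exp w - 1)‖ := by ring_nf
    _ ≤ ‖Complex.exp w - (1 + w)‖ + ‖w‖ * ‖Complex.exp w - 1‖ :=
        (norm_sub_le _ _).trans_eq (by rw [norm_mul])
    _ ≤ ‖w‖ ^ 2 * Real.exp ‖w‖ + ‖w‖ * (‖w‖ * Real.exp ‖w‖) := by gcongr
    _ = 2 * ‖w‖ ^ 2 * Real.exp ‖w‖ := by ring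

theorem tendsto_tprod_mul_exp {ι : Type*} {l : Filter ι} {y : ι → ℕ → ℝ} {Y : ℕ → ℝ} {S : ℝ}
    (hy : ∀ᶠ i in l, ∀ j : ℕ, |y i j| ≤ S / (j + 1))
    (hY : ∀ j, Tendsto (fun i => y i j) l (𝓝 (Y j))) (z : ℂ) :
    Tendsto (fun i => ∏' j, (1 - z * y i j) * Complex.exp (z * y i j)) l
      (𝓝 (∏' j, (1 - z * Y j) * Complex.exp (z * Y j))) := by
  have summable_bound : Summable fun j : ℕ =>
      2 * (‖z‖ * (S / ((j : ℝ) + 1))) ^ 2 * Real.exp (‖z‖ * S) := by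
    have h := (summable_nat_add_iff 1).2 (Real.summable_one_div_nat_pow.2 one_lt_two)
    refine (h.mul_left (2 * (‖z‖ * S) ^ 2 * Real.exp (‖z‖ * S))).congr fun j => ?_
    push_cast
    field_simp
  have h := tendsto_tprod_one_add_of_dominated_convergence (𝓕 := l)
    (f := fun i j => (1 - z * y i j) * Complex.exp (z * y i j) - 1)
    (g := fun j => (1 - z * Y j) * Complex.exp (z * Y j) - 1) summable_bound (fun j => ?_) ?_
  · simpa only [add_sub_cancel] using h
  · have hzy : Tendsto (fun i => z * (y i j : ℂ)) l (𝓝 (z * Y j)) :=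
      ((Complex.continuous_ofReal.tendsto _).comp (hY j)).const_mul z
    exact ((hzy.const_sub 1).mul hzy.cexp).sub_const 1
  · filter_upwards [hy] with i hi j
    have hS : 0 ≤ S := by simpa using (abs_nonneg _).trans (hi 0)
    have norm_le : ‖z * (y i j : ℂ)‖ ≤ ‖z‖ * (S / (j + 1)) := by
      rw [norm_mul, Complex.norm_real, Real.norm_eq_abs]
      gcongr
      exact hi j
    refine (norm_one_sub_mul_exp_sub_one_le _).trans ?_
    gcongr
    refine norm_le.trans ?_
    gcongr
    exact div_le_self hS (by simp)

theorem summable_mul_ofReal {Y : ℕ → ℝ} (hY : Summable Y) (z : ℂ) :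
    Summable fun j => z * (Y j : ℂ) :=
  (Complex.summable_ofReal.2 hY).mul_left z

theorem multipliable_one_sub_mul {Y : ℕ → ℝ} (hY : Summable Y) (z : ℂ) :
    Multipliable fun j => 1 - z * (Y j : ℂ) := by
  simpa only [sub_eq_add_neg] using
    multipliable_one_add_of_summable (summable_mul_ofReal hY z).neg.norm

theorem tprod_mul_exp {Y : ℕ → ℝ} (hY : Summable Y) (z : ℂ) :
    ∏' j, (1 - z * Y j) * Complex.exp (z * Y j) =
      (∏' j, (1 - z * (Y j : ℂ))) * Complex.exp (z * (∑' j, Y j : ℝ)) :=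
  ((multipliable_one_sub_mul hY z).hasProd.mul
    ((Complex.hasSum_ofReal.2 hY.hasSum).mul_left z).cexp).tprod_eq

theorem tprod_one_sub_mul_ne_zero {Y : ℕ → ℝ} (hY : Summable Y) (hY0 : ∀ j, 0 ≤ Y j) {z : ℂ}
    (hz : z ∈ S₀ᶜ) : ∏' j, (1 - z * (Y j : ℂ)) ≠ 0 := by
  have factor_ne_zero (j : ℕ) : 1 + -(z * (Y j : ℂ)) ≠ 0 := fun h => hz <| by
    have : z * (Y j : ℂ) = 1 := by linear_combination -h
    refine mem_S₀_iff.2 ⟨(Y j)⁻¹, inv_nonneg.2 (hY0 j), ?_⟩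
    rw [Complex.ofReal_inv, eq_inv_of_mul_eq_one_left this]
  simpa only [sub_eq_add_neg] using
    tprod_one_add_ne_zero_of_summable factor_ne_zero (summable_mul_ofReal hY z).neg.norm

theorem mem_LP_of_tprod {Y : ℕ → ℝ} (hY0 : ∀ j, 0 ≤ Y j) (hY : Summable Y) {α : ℝ} (hα : 0 ≤ α)
    {G : ℂ → ℂ} (hG : IsRealEntire G)
    (hGY : ∀ z, G z = Complex.exp (-(α : ℂ) * z) * ∏' j, (1 - z * (Y j : ℂ))) : G ∈ LP := by
  refine ⟨hG, 1, 0, α, {j // 0 < Y j}, inferInstance, fun j => (Y j)⁻¹, hα,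
    fun j => inv_pos.2 j.2, ?_, fun z => ⟨∏' j, (1 - z * (Y j : ℂ)), ?_, by simp [hGY z]⟩⟩
  · simp only [inv_inv]
    exact hY.subtype {j | 0 < Y j}
  · have support_subset : Function.mulSupport (fun j => 1 - z * (Y j : ℂ)) ⊆ {j | 0 < Y j} :=
      fun j hj => (hY0 j).lt_of_ne fun h => hj (by simp [← h])
    refine ((hasProd_subtype_iff_of_mulSupport_subset support_subset).2
      (multipliable_one_sub_mul hY z).hasProd).congr_fun fun j => ?_
    simp [div_eq_mul_inv]

section Limit

variable {ι : Type*} {l : Filter ι} {s : ι → Multiset ℝ}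
  (hs : ∀ i, ∀ y ∈ s i, 0 ≤ y) {Y : ℕ → ℝ}
  (hY : ∀ j, Tendsto (fun i => decreasingEnum (s i) j) l (𝓝 (Y j))) {σ : ℝ}
  (hσ : Tendsto (fun i => (s i).sum) l (𝓝 σ))

include hs hY hσ

theorem sum_limit_decreasingEnum_le [l.NeBot] (u : Finset ℕ) : ∑ j ∈ u, Y j ≤ σ :=
  le_of_tendsto_of_tendsto' (tendsto_finsetSum u fun j _ => hY j) hσ
    fun i => sum_decreasingEnum_le (hs i) u

/-- The mass of the inverse roots that is lost in the limit reappears as the rate of the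
exponential factor. -/
theorem tendsto_evalC_invProd (hsum : Summable Y) (z : ℂ) :
    Tendsto (fun i => evalC (invProd (s i)) z) l
      (𝓝 (Complex.exp (-((σ - ∑' j, Y j : ℝ) : ℂ) * z) * ∏' j, (1 - z * (Y j : ℂ)))) := by
  have tprod_eq (i : ι) :
      (∏' j, (1 - z * decreasingEnum (s i) j) * Complex.exp (z * decreasingEnum (s i) j)) *
        Complex.exp (-(z * (s i).sum)) = evalC (invProd (s i)) z := by
    have hprod : HasProd (fun j => 1 - z * (decreasingEnum (s i) j : ℂ)) _ :=
      hasProd_decreasingEnum (s i) (φ := fun y => 1 - z * (y : ℂ)) (by simp)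
    have hsum := hasSum_decreasingEnum_self (s i)
    rw [tprod_mul_exp hsum.summable, hprod.tprod_eq, hsum.tsum_eq, ← evalC_invProd, mul_assoc,
      ← Complex.exp_add, add_neg_cancel, Complex.exp_zero, mul_one]
  have eventually_le : ∀ᶠ i in l, ∀ j : ℕ, |decreasingEnum (s i) j| ≤ (σ + 1) / (j + 1) := by
    filter_upwards [hσ.eventually_le_const (lt_add_one σ)] with i hi j
    rw [abs_of_nonneg (decreasingEnum_nonneg (hs i) j)]
    exact decreasingEnum_le_div (hs i) hi j
  have hlim := ((tendsto_tprod_mul_exp eventually_le hY z).mul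
    (((Complex.continuous_ofReal.tendsto σ).comp hσ).const_mul z).neg.cexp).congr tprod_eq
  convert hlim using 2
  rw [tprod_mul_exp hsum, mul_assoc, ← Complex.exp_add, mul_comm]
  push_cast
  ring_nf

end Limit

theorem exists_tendsto_invProd {ι : Type*} (l : Ultrafilter ι) {s : ι → Multiset ℝ}
    (hs : ∀ i, ∀ y ∈ s i, 0 ≤ y) {S : ℝ} (hS : ∀ᶠ i in l, (s i).sum ≤ S) :
    ∃ (e : PowerSeries ℝ) (G : ℂ → ℂ), Represents e G ∧ G ∈ LP ∧ (∀ z ∈ S₀ᶜ, G z ≠ 0) ∧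
      Tendsto (fun i => (invProd (s i) : PowerSeries ℝ)) l (𝓝 e) := by
  have coeff_le : ∀ᶠ i in l, ∀ k, |(invProd (s i)).coeff k| ≤ S ^ k / (k.factorial : ℝ) :=
    hS.mono fun i hi k => abs_coeff_invProd_le (hs i) hi k
  obtain ⟨e, he⟩ := exists_tendsto_powerSeries l fun k => coeff_le.mono fun i hi => hi k
  obtain ⟨G, hG, hGlim⟩ :=
    exists_represents_of_dominated (summable_pow_div_factorial_mul_pow S) coeff_le he
  choose Y hY using fun j => exists_tendsto_of_abs_le l
    (x := fun i => decreasingEnum (s i) j) (D := S / (j + 1)) <| hS.mono fun i hi => by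
      rw [abs_of_nonneg (decreasingEnum_nonneg (hs i) j)]
      exact decreasingEnum_le_div (hs i) hi j
  obtain ⟨σ, hσ⟩ := exists_tendsto_of_abs_le l (x := fun i => (s i).sum) (D := S) <|
    hS.mono fun i hi => by rwa [abs_of_nonneg (Multiset.sum_nonneg (hs i))]
  have hY0 (j : ℕ) : 0 ≤ Y j := ge_of_tendsto' (hY j) fun i => decreasingEnum_nonneg (hs i) j
  have sum_le := sum_limit_decreasingEnum_le hs hY hσ
  have hsum : Summable Y := summable_of_sum_le hY0 sum_le
  have hGY (z : ℂ) : G z =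
      Complex.exp (-((σ - ∑' j, Y j : ℝ) : ℂ) * z) * ∏' j, (1 - z * (Y j : ℂ)) :=
    tendsto_nhds_unique (hGlim z) (tendsto_evalC_invProd hs hY hσ hsum z)
  refine ⟨e, G, hG, mem_LP_of_tprod hY0 hsum (sub_nonneg.2 (hsum.tsum_le_of_sum_le sum_le))
    hG.isRealEntire hGY, fun z hz => ?_, he⟩
  rw [hGY]
  exact mul_ne_zero (Complex.exp_ne_zero _) (tprod_one_sub_mul_ne_zero hsum hY0 hz)

/-! ### Limits of polynomials with boundedly many zeros off the half-line -/

theorem eq_coeff_order_of_le_order {f : PowerSeries ℝ} {p q : ℝ[X]} {c : ℝ} {m : ℕ}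
    (hq : q.coeff 0 = 1) (hp : p = C c * X ^ m * q) (hord : f.order ≤ (p : PowerSeries ℝ).order)
    (hp0 : p.coeff f.order.toNat ≠ 0) : m = f.order.toNat ∧ c = p.coeff f.order.toNat := by
  have coeff_p (k : ℕ) : p.coeff k = c * if m ≤ k then q.coeff (k - m) else 0 := by
    rw [hp, mul_assoc, coeff_C_mul, coeff_X_pow_mul']
  have hc : p.coeff m = c := by simp [coeff_p, hq]
  have hm : m ≤ f.order.toNat := by
    by_contra h
    exact hp0 (by rw [coeff_p, if_neg h, mul_zero])
  have hc0 : c ≠ 0 := left_ne_zero_of_mul (coeff_p _ ▸ hp0)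
  have order_le_m : f.order ≤ m := hord.trans (PowerSeries.order_le m (by rwa [coeff_coe, hc]))
  have hm' : m = f.order.toNat := hm.antisymm (ENat.toNat_le_of_le_natCast order_le_m)
  exact ⟨hm', by rw [← hm', hc]⟩

section Closure

variable {ι : Type*} {l : Filter ι} {p : ι → ℝ[X]} {f : PowerSeries ℝ} (hf : f ≠ 0)
  (hlim : Tendsto (fun i => (p i : PowerSeries ℝ)) l (𝓝 f))
  (hord : ∀ᶠ i in l, f.order ≤ (p i : PowerSeries ℝ).order)

include hf hlim hord

theorem exists_eventually_eq_X_pow_mul_invProd_mul :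
    ∃ (s : ι → Multiset ℝ) (Q : ι → ℝ[X]), (∀ i, ∀ y ∈ s i, 0 ≤ y) ∧ (∀ i, (Q i).coeff 0 = 1) ∧
      (∀ i, (Q i).natDegree ≤ outerCount (p i)) ∧
      ∀ᶠ i in l, (p i).coeff f.order.toNat ≠ 0 ∧
        p i = C ((p i).coeff f.order.toNat) * X ^ f.order.toNat * (invProd (s i) * Q i) := by
  choose c m s Q hs hQ0 hQ hp using fun i => exists_eq_C_mul_X_pow_mul_invProd_mul (p i)
  refine ⟨s, Q, hs, hQ0, hQ, ?_⟩
  filter_upwards [(tendsto_coeff hlim _).eventually_ne (PowerSeries.coeff_order hf), hord]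
    with i hi hordi
  obtain ⟨hm, hc⟩ := eq_coeff_order_of_le_order
    (by rw [mul_coeff_zero, coeff_zero_invProd, hQ0, one_mul]) (hp i) hordi hi
  have hpi := hp i
  rw [hc, hm] at hpi
  exact ⟨hi, hpi⟩

theorem exists_eq_coe_mul_of_tendsto [l.NeBot] {B : ℕ} (hB : ∀ᶠ i in l, outerCount (p i) ≤ B) :
    ∃ (P : ℝ[X]) (e : PowerSeries ℝ) (G : ℂ → ℂ), outerCount P ≤ B ∧ f = P * e ∧
      Represents e G ∧ G ∈ LP ∧ ∀ z ∈ S₀ᶜ, G z ≠ 0 := by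
  set u : Ultrafilter ι := Ultrafilter.of l
  have hu : (u : Filter ι) ≤ l := Ultrafilter.of_le l
  obtain ⟨s, Q, hs, hQ0, hQ, hp⟩ := exists_eventually_eq_X_pow_mul_invProd_mul hf hlim hord
  have hN : PowerSeries.coeff f.order.toNat f ≠ 0 := PowerSeries.coeff_order hf
  set N := f.order.toNat
  have coeff_le (k : ℕ) : ∀ᶠ i in l, |(invProd (s i) * Q i).coeff k| ≤
      |PowerSeries.coeff (k + N) f / PowerSeries.coeff N f| + 1 := by
    filter_upwards [hp, ((tendsto_coeff hlim (k + N)).div (tendsto_coeff hlim N) hN).abs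
      |>.eventually_le_const (lt_add_one _)] with i ⟨hi0, hi⟩ hle
    have coeff_p : (p i).coeff (k + N) = (p i).coeff N * (invProd (s i) * Q i).coeff k := by
      conv_lhs => rw [hi, mul_assoc, coeff_C_mul, coeff_X_pow_mul]
    rwa [Pi.div_apply, coeff_p, mul_div_cancel_left₀ _ hi0] at hle
  have hQB : ∀ᶠ i in u, (Q i).natDegree ≤ B := hu (hB.mono fun i hi => (hQ i).trans hi)
  obtain ⟨S, hS, hQS⟩ := exists_bounds_of_bounded_mul u hs hQ0 hQB fun k => hu (coeff_le k)
  obtain ⟨R, hRB, hR⟩ := exists_tendsto_polynomial u hQS hQB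
  obtain ⟨e, G, he, hG, hG0, hse⟩ := exists_tendsto_invProd u hs hS
  have f_eq : f = ((C (PowerSeries.coeff N f) * (X ^ N * R) : ℝ[X]) : PowerSeries ℝ) * e := by
    have hC := (PowerSeries.WithPiTopology.continuous_C (R := ℝ)).continuousAt.tendsto.comp
      ((tendsto_coeff hlim N).mono_left hu)
    refine tendsto_nhds_unique (hlim.mono_left hu) (Tendsto.congr' (hu ?_)
      (((hC.mul_const (PowerSeries.X ^ N)).mul (hR.mul hse)).trans_eq ?_))
    · filter_upwards [hp] with i ⟨_, hi⟩
      conv_rhs => rw [hi]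
      simp only [Function.comp_apply, coe_mul, coe_C, coe_pow, coe_X,
        mul_comm (Q i : PowerSeries ℝ)]
    · simp only [coe_mul, coe_C, coe_pow, coe_X, mul_assoc]
  have hR0 : R ≠ 0 := by
    rintro rfl
    exact hf (by simpa using f_eq)
  refine ⟨_, e, G, ?_, f_eq, he, hG, hG0⟩
  rw [outerCount_C_mul hN, outerCount_mul (pow_ne_zero _ X_ne_zero) hR0, outerCount_X_pow, zero_add]
  exact (outerCount_le_natDegree R).trans hRB

theorem exists_represents_of_tendsto [l.NeBot] {B : ℕ}
    (hB : ∀ᶠ i in l, outerCount (p i) ≤ B) :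
    ∃ F : ℂ → ℂ, Represents f F ∧ F ∈ LPStar ∧ zeroCount F S₀ᶜ ≤ B := by
  obtain ⟨P, e, G, hP, f_eq, he, hG, hG0⟩ := exists_eq_coe_mul_of_tendsto hf hlim hord hB
  have hF := (represents_coe P).mul he
  have hP0 : P ≠ 0 := by
    rintro rfl
    exact hf (by rw [f_eq, coe_zero, zero_mul])
  refine ⟨_, f_eq ▸ hF, ⟨hF.isRealEntire, P, G, hG, fun z => rfl⟩, ?_⟩
  rw [zeroCount_evalC_mul he.differentiable hP0 hG0]
  exact_mod_cast hP

end Closure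

/-! ### Counting the zeros of Appell polynomials -/

theorem order_le_order_of_coeff {f g : PowerSeries ℝ}
    (h : ∀ k, PowerSeries.coeff k f = 0 → PowerSeries.coeff k g = 0) : f.order ≤ g.order :=
  PowerSeries.le_order _ _ fun k hk => h k (PowerSeries.coeff_of_lt_order k hk)

theorem exists_represents_of_outerCount_appell_le {f : PowerSeries ℝ} (hf : f ≠ 0) {B : ℕ}
    (hB : ∀ n, outerCount (appell f n) ≤ B) :
    ∃ F : ℂ → ℂ, Represents f F ∧ F ∈ LPStar ∧ zeroCount F S₀ᶜ ≤ B := by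
  refine exists_represents_of_tendsto hf (tendsto_jensen_comp f)
    (Eventually.of_forall fun n => order_le_order_of_coeff fun k hk => ?_) ?_
  · rw [coeff_coe, comp_C_mul_X_coeff, coeff_jensen, hk, mul_zero, zero_mul]
  · filter_upwards [eventually_gt_atTop 0] with n hn
    rw [outerCount_comp_C_mul_X (by positivity), outerCount_jensen]
    exact hB n

theorem order_jensen_mono {f g : PowerSeries ℝ} (h : f.order ≤ g.order) (n : ℕ) :
    (jensen f n : PowerSeries ℝ).order ≤ (jensen g n : PowerSeries ℝ).order := by
  refine PowerSeries.le_order _ _ fun k hk => ?_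
  rw [coeff_coe, coeff_jensen]
  rcases lt_or_ge n k with hnk | hkn
  · rw [Nat.descFactorial_of_lt hnk, Nat.cast_zero, zero_mul]
  have coeff_f (j : ℕ) (hj : j < k + 1) : PowerSeries.coeff j f = 0 := by
    have hjk : j ≤ k := Nat.lt_succ_iff.1 hj
    have := PowerSeries.coeff_of_lt_order j ((Nat.cast_le.2 hjk).trans_lt hk)
    rw [coeff_coe, coeff_jensen] at this
    exact (mul_eq_zero.1 this).resolve_left
      (by exact_mod_cast (Nat.descFactorial_pos.2 (hjk.trans hkn)).ne')
  have k_lt : (k : ℕ∞) < g.order :=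
    (Nat.cast_lt.2 k.lt_succ_self).trans_le ((PowerSeries.nat_le_order f _ coeff_f).trans h)
  rw [PowerSeries.coeff_of_lt_order k k_lt, mul_zero]

theorem outerCount_appell_le_of_tendsto {ι : Type*} {l : Filter ι} [l.NeBot]
    {g : ι → PowerSeries ℝ} {f : PowerSeries ℝ} (hlim : Tendsto g l (𝓝 f))
    (hord : ∀ᶠ i in l, f.order ≤ (g i).order) {n B : ℕ}
    (hB : ∀ᶠ i in l, outerCount (appell (g i) n) ≤ B) : outerCount (appell f n) ≤ B := by
  rw [← outerCount_jensen]
  rcases eq_or_ne (jensen f n) 0 with h0 | h0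
  · rw [h0, outerCount_zero]
    exact Nat.zero_le B
  have jensen_tendsto : Tendsto (fun i => (jensen (g i) n : PowerSeries ℝ)) l
      (𝓝 (jensen f n : PowerSeries ℝ)) := by
    refine (PowerSeries.WithPiTopology.tendsto_iff_coeff_tendsto ℝ _ _ _).2 fun k => ?_
    simp only [coeff_coe, coeff_jensen]
    exact ((PowerSeries.WithPiTopology.tendsto_iff_coeff_tendsto ℝ _ _ _).1 hlim k).const_mul _
  obtain ⟨F, hF, -, hFB⟩ := exists_represents_of_tendsto (by simpa using h0) jensen_tendsto
    (hord.mono fun i hi => order_jensen_mono hi n)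
    (hB.mono fun i hi => (outerCount_jensen (g i) n).trans_le hi)
  rw [hF.unique (represents_coe _), zeroCount_evalC] at hFB
  exact_mod_cast hFB

/-- The dilation `p (M X)` is the `M`-th Jensen polynomial of a power series that tends to `p` as
`M → ∞`. -/
theorem outerCount_appell_coe_le (p : ℝ[X]) (n : ℕ) :
    outerCount (appell (p : PowerSeries ℝ) n) ≤ outerCount p := by
  set g : ℕ → PowerSeries ℝ := fun M =>
    PowerSeries.mk fun k => ((M.descFactorial k : ℝ) / (M : ℝ) ^ k)⁻¹ * p.coeff k with hg
  have g_tendsto : Tendsto g atTop (𝓝 (p : PowerSeries ℝ)) := by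
    refine (PowerSeries.WithPiTopology.tendsto_iff_coeff_tendsto ℝ _ _ _).2 fun k => ?_
    simpa only [hg, PowerSeries.coeff_mk, coeff_coe, inv_one, one_mul] using
      ((tendsto_descFactorial_div_pow k).inv₀ one_ne_zero).mul_const (p.coeff k)
  have jensen_g {M : ℕ} (hM : p.natDegree ≤ M) : jensen (g M) M = p.comp (C (M : ℝ) * X) := by
    ext k
    rw [coeff_jensen, PowerSeries.coeff_mk, comp_C_mul_X_coeff, inv_div]
    rcases lt_or_ge M k with hk | hk
    · rw [coeff_eq_zero_of_natDegree_lt (hM.trans_lt hk), mul_zero, mul_zero, zero_mul]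
    · have : (M.descFactorial k : ℝ) ≠ 0 := by
        exact_mod_cast (Nat.descFactorial_pos.2 hk).ne'
      field_simp
  refine outerCount_appell_le_of_tendsto g_tendsto (Eventually.of_forall fun M =>
    order_le_order_of_coeff fun k hk => ?_) ?_
  · rw [PowerSeries.coeff_mk, ← coeff_coe, hk, mul_zero]
  · filter_upwards [eventually_ge_atTop n, eventually_ge_atTop p.natDegree, eventually_gt_atTop 0]
      with M hnM hpM hM
    calc outerCount (appell (g M) n)
        ≤ outerCount (appell (g M) M) := monotone_outerCount_appell _ hnM
      _ = outerCount p := by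
        rw [← outerCount_jensen, jensen_g hpM, outerCount_comp_C_mul_X (by exact_mod_cast hM)]

section Approximation

variable {ι : Type*} (a : ι → ℝ) (α : ℝ)

/-- Inverse roots of a polynomial approximating `e^{-α z} ∏_j (1 - z / a_j)`: those of a partial
product, together with `M` copies of `α / M` for the factor `(1 - α z / M) ^ M`. -/
noncomputable def approxInvRoots (x : Finset ι × ℕ) : Multiset ℝ :=
  x.1.val.map (fun j => (a j)⁻¹) + Multiset.replicate x.2 (α / x.2)

variable {a α}

theorem approxInvRoots_nonneg (ha : ∀ j, 0 ≤ a j) (hα : 0 ≤ α) (x : Finset ι × ℕ) :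
    ∀ y ∈ approxInvRoots a α x, 0 ≤ y := fun y hy => by
  rcases Multiset.mem_add.1 hy with h | h
  · obtain ⟨j, -, rfl⟩ := Multiset.mem_map.1 h
    exact inv_nonneg.2 (ha j)
  · rw [(Multiset.mem_replicate.1 h).2]
    positivity

theorem sum_approxInvRoots_le (ha : ∀ j, 0 ≤ a j) (hsum : Summable fun j => (a j)⁻¹) (hα : 0 ≤ α)
    (x : Finset ι × ℕ) : (approxInvRoots a α x).sum ≤ ∑' j, (a j)⁻¹ + α := by
  rw [approxInvRoots, Multiset.sum_add, Multiset.sum_replicate, nsmul_eq_mul]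
  exact add_le_add (hsum.sum_le_tsum x.1 fun j _ => inv_nonneg.2 (ha j))
    ((mul_div_left_comm _ _ _).trans_le (mul_le_of_le_one_right hα (div_self_le_one _)))

theorem evalC_invProd_approxInvRoots (x : Finset ι × ℕ) (z : ℂ) :
    evalC (invProd (approxInvRoots a α x)) z =
      (∏ j ∈ x.1, (1 - z / (a j : ℂ))) * (1 + (-(α : ℂ) * z) / x.2) ^ x.2 := by
  rw [evalC_invProd, approxInvRoots, Multiset.map_add, Multiset.prod_add, Multiset.map_map,
    Multiset.map_replicate, Multiset.prod_replicate]
  congr 1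
  · refine congrArg Multiset.prod (Multiset.map_congr rfl fun j _ => ?_)
    rw [Function.comp_apply, Complex.ofReal_inv, div_eq_mul_inv]
  · push_cast
    ring

theorem tendsto_evalC_invProd_approxInvRoots {z p : ℂ}
    (hp : HasProd (fun j => 1 - z / (a j : ℂ)) p) :
    Tendsto (fun x => evalC (invProd (approxInvRoots a α x)) z) (atTop ×ˢ atTop)
      (𝓝 (p * Complex.exp (-(α : ℂ) * z))) := by
  simp_rw [evalC_invProd_approxInvRoots]
  exact (Tendsto.comp (show Tendsto _ atTop (𝓝 p) from hp) tendsto_fst).mul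
    ((Complex.tendsto_one_add_div_pow_exp _).comp tendsto_snd)

end Approximation

theorem exists_tendsto_invProd_of_mem_LP {g : ℂ → ℂ} (hg : g ∈ LP) :
    ∃ (κ : Type) (l : Ultrafilter κ) (s : κ → Multiset ℝ) (e : PowerSeries ℝ) (G : ℂ → ℂ)
      (c : ℝ) (m : ℕ), (∀ x, ∀ y ∈ s x, 0 ≤ y) ∧
        Tendsto (fun x => (invProd (s x) : PowerSeries ℝ)) l (𝓝 e) ∧ Represents e G ∧
        ∀ z, g z = c * z ^ m * G z := by
  obtain ⟨-, c, m, α, ι, -, a, hα, ha, hsum, hprod⟩ := hg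
  set l : Ultrafilter (Finset ι × ℕ) := Ultrafilter.of (atTop ×ˢ atTop)
  have hs := approxInvRoots_nonneg (fun j => (ha j).le) hα
  have coeff_le (x : Finset ι × ℕ) :=
    abs_coeff_invProd_le (hs x) (sum_approxInvRoots_le (fun j => (ha j).le) hsum hα x)
  obtain ⟨e, he⟩ := exists_tendsto_powerSeries l fun k =>
    Eventually.of_forall fun x => coeff_le x k
  obtain ⟨G, hG, hGlim⟩ := exists_represents_of_dominated
    (summable_pow_div_factorial_mul_pow _) (Eventually.of_forall coeff_le) he
  refine ⟨_, l, _, e, G, c, m, hs, he, hG, fun z => ?_⟩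
  obtain ⟨p, hp, hgz⟩ := hprod z
  rw [hgz, tendsto_nhds_unique (hGlim z)
    ((tendsto_evalC_invProd_approxInvRoots hp).mono_left (Ultrafilter.of_le _))]
  ring

theorem outerCount_appell_le_of_represents {f : PowerSeries ℝ} (hf0 : f ≠ 0) {P : ℝ[X]}
    {g : ℂ → ℂ} (hg : g ∈ LP) (hf : Represents f fun z => evalC P z * g z) (n : ℕ) :
    outerCount (appell f n) ≤ outerCount P := by
  obtain ⟨κ, l, s, e, G, c, m, hs, he, hG, hgG⟩ := exists_tendsto_invProd_of_mem_LP hg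
  have f_eq : f = ((X ^ m * (C c * P) : ℝ[X]) : PowerSeries ℝ) * e := by
    refine hf.coeff_unique ?_
    convert (represents_coe (X ^ m * (C c * P))).mul hG using 2 with z
    rw [hgG, evalC_mul, evalC_mul]
    simp only [evalC, map_pow, aeval_X, aeval_C, Complex.coe_algebraMap]
    ring
  have hP : C c * P ≠ 0 := fun h => hf0 (by simp [f_eq, h])
  have hc : c ≠ 0 := fun h => left_ne_zero_of_mul hP (by rw [h, C_0])
  have order_e : e.order = 0 := by
    have coeff_e : PowerSeries.coeff 0 e = 1 :=
      tendsto_nhds_unique (tendsto_coeff he 0) (by simp [coeff_zero_invProd])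
    exact nonpos_iff_eq_zero.1 (PowerSeries.order_le 0 (coeff_e ▸ one_ne_zero))
  refine outerCount_appell_le_of_tendsto (l := (l : Filter κ)) (f_eq ▸ he.const_mul _)
    (Eventually.of_forall fun x => ?_) (Eventually.of_forall fun x => ?_)
  · rw [f_eq, PowerSeries.order_mul, PowerSeries.order_mul, order_e]
    gcongr
    exact zero_le
  · rw [← coe_mul]
    refine (outerCount_appell_coe_le _ n).trans_eq ?_
    rw [mul_assoc, mul_comm (C c * P), outerCount_X_pow_mul_invProd_mul m (hs x) hP,
      outerCount_C_mul hc]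

theorem zero_mem_LPStar : (0 : ℂ → ℂ) ∈ LPStar := by
  have hzero : IsRealEntire 0 := represents_zero.isRealEntire
  exact ⟨hzero, 0, 0, ⟨hzero, 0, 0, 0, Empty, inferInstance, fun _ => 1, le_rfl,
    fun _ => one_pos, hasSum_empty.summable, fun z => ⟨1, hasProd_empty, by simp⟩⟩,
    fun z => by simp⟩

theorem exists_represents_of_appellCount_le {f : PowerSeries ℝ} {B : ℕ}
    (hB : ∀ n, appellCount f n ≤ B) :
    ∃ F : ℂ → ℂ, Represents f F ∧ F ∈ LPStar ∧ zeroCount F S₀ᶜ ≤ B := by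
  rcases eq_or_ne f 0 with rfl | hf
  · exact ⟨0, represents_zero, zero_mem_LPStar, by simp [zeroCount]⟩
  · exact exists_represents_of_outerCount_appell_le hf fun n => by
      exact_mod_cast (appellCount_eq f n).symm.trans_le (hB n)

section

variable {f : PowerSeries ℝ} {F : ℂ → ℂ} (hf : Represents f F) (hF : F ∈ LPStar)

include hf hF

theorem exists_appellCount_le :
    ∃ B : ℕ, (∀ n, appellCount f n ≤ B) ∧ B ≤ zeroCount F S₀ᶜ := by
  rcases eq_or_ne f 0 with rfl | hf0
  · exact ⟨0, fun n => by simp [appellCount_eq, appell_zero, outerCount_zero], zero_le⟩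
  obtain ⟨-, P, g, hg, hFg⟩ := hF
  obtain rfl : F = fun z => evalC P z * g z := funext hFg
  refine ⟨outerCount P, fun n => ?_,
    outerCount_le_zeroCount_evalC_mul hg.1.1 fun h => hf0 (hf.coeff_unique (h ▸ represents_zero))⟩
  rw [appellCount_eq, Nat.cast_le]
  exact outerCount_appell_le_of_represents hf0 hg hf n

theorem appellCount_le_zeroCount (n : ℕ) : appellCount f n ≤ zeroCount F S₀ᶜ := by
  obtain ⟨B, hB, hBF⟩ := exists_appellCount_le hf hF
  exact (hB n).trans hBF

theorem exists_appellCount_eq_zeroCount :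
    ∃ n₀ : ℕ, ∀ n, n₀ ≤ n → appellCount f n = zeroCount F S₀ᶜ := by
  have zeroCount_le {B : ℕ} (hB : ∀ n, appellCount f n ≤ B) : zeroCount F S₀ᶜ ≤ B := by
    obtain ⟨F', hF', -, hle⟩ := exists_represents_of_appellCount_le hB
    rwa [hf.unique hF']
  obtain ⟨B, hB, hBF⟩ := exists_appellCount_le hf hF
  have zeroCount_eq : zeroCount F S₀ᶜ = B := (zeroCount_le hB).antisymm hBF
  obtain ⟨n₀, hn₀⟩ : ∃ n₀, (B : ℕ∞) ≤ appellCount f n₀ := by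
    by_contra! hlt
    rcases B with _ | B
    · exact not_lt_zero (hlt 0)
    · have := zeroCount_le fun n => (ENat.lt_add_one_iff (ENat.natCast_ne_top B)).1 (hlt n)
      rw [zeroCount_eq, Nat.cast_le] at this
      omega
  refine ⟨n₀, fun n hn => (appellCount_le_zeroCount hf hF n).antisymm ?_⟩
  exact zeroCount_eq ▸ hn₀.trans (monotone_nat_of_le_succ (appellCount_le_succ f) hn)

end

end PolyaAppell

theorem theorem3p5 (f : PowerSeries ℝ) :
    -- part (1)
    (PolyaAppell.appellCount f 0 = 0 ∧
      ∀ n : ℕ, PolyaAppell.appellCount f n ≤ PolyaAppell.appellCount f (n + 1)) ∧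
    -- part (2)
    (∀ F : ℂ → ℂ, PolyaAppell.Represents f F → F ∈ PolyaAppell.LPStar →
      (∀ n : ℕ, PolyaAppell.appellCount f n ≤ PolyaAppell.zeroCount F PolyaAppell.S₀ᶜ) ∧
      ∃ n₀ : ℕ, ∀ n : ℕ, n₀ ≤ n →
        PolyaAppell.appellCount f n = PolyaAppell.zeroCount F PolyaAppell.S₀ᶜ) ∧
    -- part (3)
    ((∃ B : ℕ, ∀ n : ℕ, PolyaAppell.appellCount f n ≤ (B : ℕ∞)) →
      ∃ F : ℂ → ℂ, PolyaAppell.Represents f F ∧ F ∈ PolyaAppell.LPStar) := by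
  refine ⟨⟨PolyaAppell.appellCount_zero f, PolyaAppell.appellCount_le_succ f⟩,
    fun F hf hF => ⟨PolyaAppell.appellCount_le_zeroCount hf hF,
      PolyaAppell.exists_appellCount_eq_zeroCount hf hF⟩, ?_⟩
  rintro ⟨B, hB⟩
  obtain ⟨F, hf, hF, -⟩ := PolyaAppell.exists_represents_of_appellCount_le hB
  exact ⟨F, hf, hF⟩
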